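/- Let $n\in\mathbb N$, $1<\alpha\le 2$, and $\mu_j>0$, $0<\gamma_j\le 2$ for $j=1,\dots,n$. Write $h^{*}(k)=\frac1{\sqrt{2\pi}}\int_{-\infty}^{\infty}e^{ikx}h(x)\,dx$ for the Fourier transform in $x$, let ${}_0D_t^{\nu}$ be the Riemann--Liouville derivative based at $0$: for $\nu>0$, ${}_0D_t^{\nu}h=\frac{d^m}{dt^m}\,{}_0I_t^{m-\nu}h$ with $m=[\nu]+1$, and for $\nu\le 0$, ${}_0D_t^{\nu}h={}_0I_t^{-\nu}h$, where ${}_0I_t^{\beta}h(t)=\frac1{\Gamma(\beta)}\int_0^t(t-u)^{\beta-1}h(u)\,du$ for $\beta>0$ and ${}_0I_t^0h=h$. Let ${}_xD_0^{\gamma}$ be the Riesz derivative, that is, the pseudo-differential operator with symbol $-|k|^{\gamma}$: ${}_xD_0^{\gamma}h(x)=-\frac1{\sqrt{2\pi}}\int_{-\infty}^{\infty}e^{-ikx}|k|^{\gamma}h^{*}(k)\,dk$. Put $$\sigma(k)=\sum_{j=1}^n\mu_j|k|^{\gamma_j},\qquad E_{a,b}(z)=\sum_{r=0}^{\infty}\frac{z^r}{\Gamma(ar+b)}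 .$$ Let $f,g:\mathbb R\to\mathbb C$ be integrable with integrable Fourier transforms $f^{*},g^{*}$, and let $\phi(x,t)$ be such that, for every $T>0$, $\phi$ is integrable in $(x,t)$ and $\phi^{*}(k,t)$ is integrable in $(k,t)$ on $\mathbb R\times(0,T]$. Let $N(x,t)$, $x\in\mathbb R$, $t>0$, be a (complex-valued) solution of $${}_0D_t^{\alpha}N(x,t)=\sum_{j=1}^n\mu_j\,{}_xD_0^{\gamma_j}N(x,t)+\phi(x,t)\qquad(x\in\mathbb R,\ t>0),$$ $$\lim_{t\to0+}{}_0D_t^{\alpha-1}N(x,t)=f(x),\qquad \lim_{t\to0+}{}_0D_t^{\alpha-2}N(x,t)=g(x)\quad(x\in\mathbb R),\qquad \lim_{x\to\pm\infty}N(x,t)=0\quad(t>0),$$ in the following classical sense: $N$ is continuous on $\mathbb R\times(0,\infty)$; $t\mapsto N(\cdot,t)$ is a continuous map from $(0,\infty)$ to $L^1(\mathbb R)$; for every $T>0$, $N$ is integrable on $\mathbb R\times(0,T]$ and $N(x,\cdot)$ is integrable on $(0,T]$ for each $x$; ${}_0D_t^{\alpha}N$ exists for all $x\in\mathbb R$ and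 $t>0$ and is integrable on $\mathbb R\times(0,T]$ for every $T>0$; and $|k|^{\gamma_j}N^{*}(k,t)$ is integrable in $k$ for all $t>0$ and all $j$. Then for every $t>0$ the functions $E_{\alpha,\alpha}[-\sigma(k)t^{\alpha}]f^{*}(k)$ and $E_{\alpha,\alpha-1}[-\sigma(k)t^{\alpha}]g^{*}(k)$ of $k\in\mathbb R$ and the function $\xi^{\alpha-1}E_{\alpha,\alpha}[-\sigma(k)\xi^{\alpha}]\phi^{*}(k,t-\xi)$ of $(\xi,k)\in(0,t]\times\mathbb R$ are integrable, and for every $x\in\mathbb R$ $$\begin{aligned}N(x,t)={}&\frac{t^{\alpha-1}}{\sqrt{2\pi}}\int_{-\infty}^{\infty}e^{-ikx}E_{\alpha,\alpha}[-\sigma(k)t^{\alpha}]\,f^{*}(k)\,dk+\frac{t^{\alpha-2}}{\sqrt{2\pi}}\int_{-\infty}^{\infty}e^{-ikx}E_{\alpha,\alpha-1}[-\sigma(k)t^{\alpha}]\,g^{*}(k)\,dk\\&+\frac1{\sqrt{2\pi}}\int_0^t\xi^{\alpha-1}\int_{-\infty}^{\infty}E_{\alpha,\alpha}[-\sigma(k)\xi^{\alpha}]\,e^{-ikx}\phi^{*}(k,t-\xi)\,dk\,d\xi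 .\end{aligned}$$ -/

import Mathlib

open MeasureTheory Filter Topology Set

noncomputable section

namespace FracDiff

/-- Unitary Fourier transform `h*(k) = (2π)^{-1/2} ∫ e^{ikx} h(x) dx`
(its inverse has the kernel `e^{-ikx}` and the same constant). -/
def fourierT (h : ℝ → ℂ) (k : ℝ) : ℂ :=
  ((1 / Real.sqrt (2 * Real.pi) : ℝ) : ℂ) *
    ∫ x : ℝ, Complex.exp (Complex.I * (k : ℂ) * (x : ℂ)) * h x

/-- The Mittag-Leffler function `E_{a,b}(z) = ∑ zⁿ / Γ(a n + b)` at a real argument. -/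
def mittagLeffler (a b z : ℝ) : ℝ :=
  ∑' n : ℕ, z ^ n / Real.Gamma (a * n + b)

/-- Riemann-Liouville integral of order `ν ≥ 0` based at `0`; order `0` is the identity. -/
def rlIntegral (ν : ℝ) (h : ℝ → ℂ) (t : ℝ) : ℂ :=
  if ν = 0 then h t
  else ((1 / Real.Gamma ν : ℝ) : ℂ) * ∫ u in (0 : ℝ)..t, (((t - u) ^ (ν - 1) : ℝ) : ℂ) * h u

/-- The integer `m = [ν + 1] = [ν] + 1` in the Riemann-Liouville derivative of order `ν > 0`. -/
def rlOrder (ν : ℝ) : ℕ := ⌊ν⌋₊ + 1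

/-- Riemann-Liouville derivative of order `ν`: the `m`-th derivative of the integral of order
`m - ν` if `ν > 0`, and the integral of order `-ν` if `ν ≤ 0`. -/
def rlDeriv (ν : ℝ) (h : ℝ → ℂ) (t : ℝ) : ℂ :=
  if 0 < ν then iteratedDeriv (rlOrder ν) (rlIntegral ((rlOrder ν : ℝ) - ν) h) t
  else rlIntegral (-ν) h t

/-- The derivative of order `ν > 0` exists as a genuine derivative at every `t > 0`. -/
def RLDifferentiable (ν : ℝ) (h : ℝ → ℂ) : Prop :=
  ∀ t : ℝ, 0 < t → ∀ i < rlOrder ν,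
    DifferentiableAt ℝ (iteratedDeriv i (rlIntegral ((rlOrder ν : ℝ) - ν) h)) t

/-- Riesz space derivative of order `c`, the pseudo-differential operator with symbol `-|k|^c`. -/
def rieszDeriv (c : ℝ) (h : ℝ → ℂ) (x : ℝ) : ℂ :=
  ((1 / Real.sqrt (2 * Real.pi) : ℝ) : ℂ) *
    ∫ k : ℝ, Complex.exp (-(Complex.I * (k : ℂ) * (x : ℂ))) *
      (-((|k| ^ c : ℝ) : ℂ) * fourierT h k)

/-- `h` is integrable and `|k|^c h*(k)` is integrable: the integrals that define
`rieszDeriv c h` converge. -/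
def RieszDomain (c : ℝ) (h : ℝ → ℂ) : Prop :=
  Integrable h ∧ Integrable (fun k : ℝ => ((|k| ^ c : ℝ) : ℂ) * fourierT h k)

/-- `σ(k) = ∑ μ_j |k|^{γ_j}`. -/
def symbol {n : ℕ} (μ γ : Fin n → ℝ) (k : ℝ) : ℝ := ∑ j, μ j * |k| ^ γ j

/-- The regularity under which the problem is read classically. The function `N x t` may be
singular as `t → 0+`, in a way that is integrable in time. -/
structure Admissible {n : ℕ} (α : ℝ) (γ : Fin n → ℝ) (N : ℝ → ℝ → ℂ) : Prop where
  /-- `N` is continuous for `t > 0`. -/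
  cont : ContinuousOn (Function.uncurry N) (univ ×ˢ Ioi 0)
  /-- `N(·,t)` is an integrable function of `x` … -/
  int_space : ∀ t : ℝ, 0 < t → Integrable (fun x => N x t)
  /-- … that depends continuously on `t > 0` in the `L¹` norm. -/
  cont_L1 : ∀ t : ℝ, 0 < t → Tendsto (fun s => ∫ x, ‖N x s - N x t‖) (𝓝 t) (𝓝 0)
  /-- `N` is integrable up to `t = 0`, for each `x` and on each strip. -/
  int_time : ∀ x T : ℝ, IntegrableOn (N x) (Ioc 0 T)
  int_strip : ∀ T : ℝ, IntegrableOn (Function.uncurry N) (univ ×ˢ Ioc 0 T)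
  /-- The time derivative of order `α` exists and is integrable on each strip. -/
  diff_time : ∀ x : ℝ, RLDifferentiable α (N x)
  int_deriv : ∀ T : ℝ,
    IntegrableOn (fun p : ℝ × ℝ => rlDeriv α (N p.1) p.2) (univ ×ˢ Ioc 0 T)
  /-- The Riesz derivatives exist for `t > 0`. -/
  riesz : ∀ t : ℝ, 0 < t → ∀ j, RieszDomain (γ j) (fun x => N x t)

end FracDiff

end

open FracDiff

/-!
For `σ ≥ 0` let `e_b(t) = t^{b-1} E_{α,b}(-σ t^α)`, and let `*` be convolution over `(0, t)`. The
series of `e_b` shows that a Riemann-Liouville integral of order `b` turns `e_c` into `e_{b+c}`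
(`integral_rl_mlKernel`), and that `e_1 + σ e_{α+1} = 1` (`mlKernel_one_add`).

At a fixed `x`, the equation says that the integral of order `2 - α` of `N(x, ·)` has second
derivative `w = D^α N(x, ·)` and initial values `g(x)`, `f(x)`. Taylor's formula, convolved with
`e_{α-1}`, gives `e_1 * N = g e_α + f e_{α+1} + e_{α+1} * w` (`integral_mlKernel_one_mul`). These
kernels are bounded on `(0, t)`, so the Fourier transform in `x` commutes with the convolutions. For
almost every time the transform of `w` is `-σ(k) N^* + φ^*`: the sum of the Riesz derivatives is
integrable, as the difference of `w` and `φ`, so that Fourier inversion applies to it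
(`fourierT_of_eq_sum_rieszDeriv`). With `σ = σ(k)` the terms with `N^*` add up to the plain integral
of `N^*` over `(0, t)`. Differentiation in `t` gives
`N^* = g^* e_{α-1} + f^* e_α + e_α * φ^*` for all `k` and all `t > 0` (`fourierT_solution`), both
sides being continuous in `t`. No uniqueness theorem and no growth condition in time is needed.

It remains to invert the Fourier transform, for which the three terms must be integrable in `k`.
This holds because `E_{α,α}` and `E_{α,α-1}` are bounded on the negative half-line. Termwise
integration of the Bromwich integral for `1 / Γ` (`integral_exp_mul_cpow_neg`) represents
`E_{α,α-1}(-y)` by an integral over a vertical line `Re s = c` with `c > y` (`integral_mlSymbol`).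
For `α < 2` the integrand has no poles with `Re s > 0`, and the line can be moved to `Re s = 1`,
where there is a bound uniform in `y` (`exists_abs_mittagLeffler_sub_one_le`). The bound for
`E_{α,α}` follows by integration in `t`.
-/

open FracDiff

/-! ### The Mittag-Leffler function and the kernels `e_b` -/

theorem summable_mittagLeffler {a b : ℝ} (ha : 1 ≤ a) (hb : 0 ≤ b) (z : ℝ) :
    Summable fun r : ℕ => z ^ r / Real.Gamma (a * r + b) := by
  -- from `r = 2` on, `Γ(a r + b) ≥ Γ(r)`, since `Γ` is increasing on `[2, ∞)`
  have hs : Summable fun r : ℕ => |z| ^ (r + 2) / (r + 1).factorial := by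
    have := ((summable_nat_add_iff 1).mpr (Real.summable_pow_div_factorial |z|)).mul_left |z|
    refine this.congr fun r => ?_
    rw [pow_succ' _ (r + 1)]
    ring
  rw [← summable_nat_add_iff 2]
  refine Summable.of_norm_bounded hs fun r => ?_
  have h2 : (2 : ℝ) ≤ ((r + 2 : ℕ) : ℝ) := by
    push_cast; linarith [(Nat.cast_nonneg r : (0 : ℝ) ≤ r)]
  have hle : ((r + 2 : ℕ) : ℝ) ≤ a * ((r + 2 : ℕ) : ℝ) + b := by nlinarith
  have hG : ((r + 1).factorial : ℝ) ≤ Real.Gamma (a * ((r + 2 : ℕ) : ℝ) + b) := by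
    have := Real.Gamma_strictMonoOn_Ici.monotoneOn (mem_Ici.2 h2) (mem_Ici.2 (h2.trans hle)) hle
    rwa [show (((r + 2 : ℕ) : ℝ)) = ((r + 1 : ℕ) : ℝ) + 1 by push_cast; ring,
      Real.Gamma_nat_eq_factorial,
      show (((r + 1 : ℕ) : ℝ)) + 1 = ((r + 2 : ℕ) : ℝ) by push_cast; ring] at this
  have hpos : (0 : ℝ) < (r + 1).factorial := by positivity
  rw [norm_div, norm_pow, Real.norm_eq_abs, Real.norm_eq_abs, abs_of_pos (hpos.trans_le hG)]
  gcongr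

theorem continuous_mittagLeffler {a b : ℝ} (ha : 1 ≤ a) (hb : 0 ≤ b) :
    Continuous (mittagLeffler a b) := by
  rw [continuous_iff_continuousAt]
  intro z₀
  have : ContinuousOn (mittagLeffler a b) (Icc (-(|z₀| + 1)) (|z₀| + 1)) := by
    refine continuousOn_tsum (u := fun r : ℕ => ‖(|z₀| + 1) ^ r / Real.Gamma (a * r + b)‖)
      (fun r => by fun_prop) (summable_mittagLeffler ha hb _).norm fun r z hz => ?_
    rw [norm_div, norm_div, norm_pow, norm_pow]
    have : ‖z‖ ≤ ‖|z₀| + 1‖ := by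
      rw [Real.norm_eq_abs, Real.norm_eq_abs, abs_of_nonneg (by positivity : 0 ≤ |z₀| + 1)]
      exact abs_le.2 hz
    gcongr
  refine this.continuousAt (Icc_mem_nhds ?_ ?_)
  · linarith [neg_abs_le z₀]
  · linarith [le_abs_self z₀]

theorem Gamma_nat_mul_add_pos {a b : ℝ} (ha : 0 ≤ a) (hb : 0 < b) (r : ℕ) :
    0 < Real.Gamma (a * r + b) := Real.Gamma_pos_of_pos (by positivity)

theorem abs_mittagLeffler_le {a b z y : ℝ} (ha : 1 ≤ a) (hb : 0 < b) (hz : |z| ≤ y) :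
    |mittagLeffler a b z| ≤ mittagLeffler a b y := by
  rw [← Real.norm_eq_abs]
  refine tsum_of_norm_bounded (summable_mittagLeffler ha hb.le y).hasSum fun r => ?_
  have := Gamma_nat_mul_add_pos (by linarith) hb r (a := a)
  rw [norm_div, norm_pow, Real.norm_eq_abs, Real.norm_eq_abs, abs_of_pos this]
  gcongr

/-- The kernel `e_b(t) = t^{b-1} E_{a,b}(-σ t^a)`, whose Laplace transform is
`s^{a-b} / (s^a + σ)`. It is used for `t > 0` only. -/
noncomputable def mlKernel (a b σ t : ℝ) : ℝ := t ^ (b - 1) * mittagLeffler a b (-σ * t ^ a)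

theorem mlKernel_hasSum {a b : ℝ} (ha : 1 ≤ a) (hb : 0 ≤ b) (σ : ℝ) {t : ℝ} (ht : 0 < t) :
    HasSum (fun r : ℕ => (-σ) ^ r * (t ^ (a * r + b - 1) / Real.Gamma (a * r + b)))
      (mlKernel a b σ t) := by
  refine ((summable_mittagLeffler ha hb (-σ * t ^ a)).hasSum.mul_left (t ^ (b - 1))).congr_fun
    fun r => ?_
  rw [mul_pow, ← Real.rpow_natCast (t ^ a), ← Real.rpow_mul ht.le,
    show a * r + b - 1 = (b - 1) + a * r by ring, Real.rpow_add ht]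
  ring

theorem measurable_mlKernel {a b : ℝ} (ha : 1 ≤ a) (hb : 0 ≤ b) (σ : ℝ) :
    Measurable (mlKernel a b σ) := by
  unfold mlKernel
  have := (continuous_mittagLeffler ha hb).measurable
  fun_prop

theorem continuousAt_mlKernel {a b : ℝ} (ha : 1 ≤ a) (hb : 0 ≤ b) (σ : ℝ) {t : ℝ} (ht : 0 < t) :
    ContinuousAt (mlKernel a b σ) t := by
  unfold mlKernel
  have h1 : ContinuousAt (fun t : ℝ => t ^ (b - 1)) t :=
    Real.continuousAt_rpow_const _ _ (Or.inl ht.ne')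
  have h2 : ContinuousAt (fun t : ℝ => -σ * t ^ a) t :=
    continuousAt_const.mul (Real.continuousAt_rpow_const _ _ (Or.inl ht.ne'))
  exact h1.mul ((continuous_mittagLeffler ha hb).continuousAt.comp h2)

theorem continuous_mlKernel {a b : ℝ} (ha : 1 ≤ a) (hb : 1 ≤ b) (σ : ℝ) :
    Continuous (mlKernel a b σ) := by
  unfold mlKernel
  exact (Real.continuous_rpow_const (by linarith)).mul
    ((continuous_mittagLeffler ha (by linarith)).comp
      (continuous_const.mul (Real.continuous_rpow_const (by linarith))))

theorem abs_mlKernel_le {a b : ℝ} (ha : 1 ≤ a) (hb : 0 < b) (σ : ℝ) {t : ℝ} (ht : 0 < t) :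
    |mlKernel a b σ t| ≤ mlKernel a b (-|σ|) t := by
  unfold mlKernel
  rw [abs_mul, abs_of_pos (Real.rpow_pos_of_pos ht _)]
  gcongr
  refine abs_mittagLeffler_le ha hb ?_
  rw [abs_mul, abs_neg, neg_neg, abs_of_pos (Real.rpow_pos_of_pos ht a)]

/-- The Beta integral in real form. -/
theorem integral_rpow_mul_rpow {b c t : ℝ} (hb : 0 < b) (hc : 0 < c) (ht : 0 < t) :
    ∫ s in (0 : ℝ)..t, (t - s) ^ (b - 1) * s ^ (c - 1) =
      t ^ (b + c - 1) * (Real.Gamma b * Real.Gamma c / Real.Gamma (b + c)) := by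
  have h := Complex.betaIntegral_scaled (c : ℂ) (b : ℂ) ht
  rw [Complex.betaIntegral_eq_Gamma_mul_div _ _ (by simpa) (by simpa)] at h
  have h2 : ∫ x in (0 : ℝ)..t, (x : ℂ) ^ ((c : ℂ) - 1) * ((t : ℂ) - x) ^ ((b : ℂ) - 1)
      = ∫ x in (0 : ℝ)..t, (((t - x) ^ (b - 1) * x ^ (c - 1) : ℝ) : ℂ) := by
    refine intervalIntegral.integral_congr fun x hx => ?_
    rw [uIcc_of_le ht.le] at hx
    rw [← Complex.ofReal_one, ← Complex.ofReal_sub, ← Complex.ofReal_sub, ← Complex.ofReal_sub,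
      ← Complex.ofReal_cpow hx.1, ← Complex.ofReal_cpow (sub_nonneg.2 hx.2), ← Complex.ofReal_mul,
      mul_comm]
  rw [h2, intervalIntegral.integral_ofReal, ← Complex.ofReal_add, Complex.Gamma_ofReal,
    Complex.Gamma_ofReal, Complex.Gamma_ofReal, ← Complex.ofReal_one, ← Complex.ofReal_sub,
    ← Complex.ofReal_cpow ht.le] at h
  norm_cast at h
  rw [h, add_comm c b]
  ring

/-- Integrability of the Beta integrand, read off from the nonzero value of its integral. -/
theorem integrableOn_rpow_mul_rpow {b c t : ℝ} (hb : 0 < b) (hc : 0 < c) (ht : 0 < t) :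
    IntegrableOn (fun s => (t - s) ^ (b - 1) * s ^ (c - 1)) (Ioc 0 t) := by
  by_contra h
  have h1 := integral_rpow_mul_rpow hb hc ht
  rw [intervalIntegral.integral_of_le ht.le, integral_undef h] at h1
  have := Real.Gamma_pos_of_pos hb
  have := Real.Gamma_pos_of_pos hc
  have := Real.Gamma_pos_of_pos (add_pos hb hc)
  have : 0 < t ^ (b + c - 1) * (Real.Gamma b * Real.Gamma c / Real.Gamma (b + c)) := by positivity
  linarith

/-- The Riemann-Liouville integral of order `b` of the terms of the series for `e_c`. -/
theorem rl_mlKernel_terms {a b c : ℝ} (ha : 1 ≤ a) (hb : 0 < b) (hc : 0 < c) (σ : ℝ) {t : ℝ}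
    (ht : 0 < t) :
    (∀ r : ℕ, IntegrableOn (fun s => (t - s) ^ (b - 1) / Real.Gamma b *
      ((-σ) ^ r * (s ^ (a * r + c - 1) / Real.Gamma (a * r + c)))) (Ioc 0 t)) ∧
    ∀ r : ℕ, ∫ s in Ioc 0 t, (t - s) ^ (b - 1) / Real.Gamma b *
      ((-σ) ^ r * (s ^ (a * r + c - 1) / Real.Gamma (a * r + c))) =
      (-σ) ^ r * (t ^ (a * r + (b + c) - 1) / Real.Gamma (a * r + (b + c))) := by
  have hG := Real.Gamma_pos_of_pos hb
  have hGr := fun r : ℕ => Gamma_nat_mul_add_pos (by linarith : 0 ≤ a) hc r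
  have hrc : ∀ r : ℕ, 0 < a * r + c := fun r => by positivity
  have hform : ∀ r : ℕ, (fun s => (t - s) ^ (b - 1) / Real.Gamma b *
      ((-σ) ^ r * (s ^ (a * r + c - 1) / Real.Gamma (a * r + c)))) = fun s =>
      ((-σ) ^ r / (Real.Gamma b * Real.Gamma (a * r + c))) *
        ((t - s) ^ (b - 1) * s ^ (a * r + c - 1)) := fun r => by
    funext s
    have := (hGr r).ne'
    field_simp
  constructor
  · intro r
    rw [hform]
    exact (integrableOn_rpow_mul_rpow hb (hrc r) ht).const_mul _
  · intro r
    rw [hform, integral_const_mul, ← intervalIntegral.integral_of_le ht.le,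
      integral_rpow_mul_rpow hb (hrc r) ht, show b + (a * r + c) = a * r + (b + c) by ring]
    have := (hGr r).ne'
    field_simp

/-- The Riemann-Liouville integral of order `b` turns `e_c` into `e_{b+c}`. -/
theorem integral_rl_mlKernel {a b c : ℝ} (ha : 1 ≤ a) (hb : 0 < b) (hc : 0 < c) (σ : ℝ) {t : ℝ}
    (ht : 0 < t) :
    ∫ s in Ioc 0 t, (t - s) ^ (b - 1) / Real.Gamma b * mlKernel a c σ s =
      mlKernel a (b + c) σ t := by
  obtain ⟨h1, h2⟩ := rl_mlKernel_terms ha hb hc σ ht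
  obtain ⟨-, h2'⟩ := rl_mlKernel_terms ha hb hc (-|σ|) ht
  -- the norms of the terms are the terms for `-|σ|` in place of `σ`
  have hnorm : ∀ r : ℕ, ∫ s in Ioc 0 t, ‖(t - s) ^ (b - 1) / Real.Gamma b *
      ((-σ) ^ r * (s ^ (a * r + c - 1) / Real.Gamma (a * r + c)))‖ =
      (- -|σ|) ^ r * (t ^ (a * r + (b + c) - 1) / Real.Gamma (a * r + (b + c))) := fun r => by
    rw [← h2' r]
    refine setIntegral_congr_fun measurableSet_Ioc fun s hs => ?_
    have := Real.Gamma_pos_of_pos hb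
    have := Gamma_nat_mul_add_pos (by linarith : 0 ≤ a) hc r
    have h3 : 0 ≤ t - s := sub_nonneg.2 hs.2
    have h4 := hs.1
    simp only [norm_mul, norm_pow, norm_neg, Real.norm_eq_abs]
    rw [neg_neg, abs_of_nonneg (by positivity : 0 ≤ (t - s) ^ (b - 1) / Real.Gamma b),
      abs_of_nonneg (by positivity : 0 ≤ s ^ (a * r + c - 1) / Real.Gamma (a * r + c))]
  have hsum := hasSum_integral_of_summable_integral_norm (μ := volume.restrict (Ioc 0 t)) h1
    ((mlKernel_hasSum ha (add_pos hb hc).le (-|σ|) ht).summable.congr fun r => (hnorm r).symm)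
  simp_rw [h2] at hsum
  rw [← hsum.unique (mlKernel_hasSum ha (add_pos hb hc).le σ ht)]
  refine setIntegral_congr_fun measurableSet_Ioc fun s hs => ?_
  exact ((mlKernel_hasSum ha hc.le σ hs.1).mul_left _).tsum_eq.symm

theorem integrableOn_rl_mlKernel {a b c : ℝ} (ha : 1 ≤ a) (hb : 0 < b) (hc : 0 < c) (σ : ℝ) {t : ℝ}
    (ht : 0 < t) :
    IntegrableOn (fun s => (t - s) ^ (b - 1) / Real.Gamma b * mlKernel a c σ s) (Ioc 0 t) := by
  have hG := Real.Gamma_pos_of_pos hb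
  refine Integrable.mono' (((integrableOn_rpow_mul_rpow hb hc ht).const_mul
    (mittagLeffler a c (|σ| * t ^ a))).div_const (Real.Gamma b)) ?_ ?_
  · have := measurable_mlKernel ha hc.le σ
    exact Measurable.aestronglyMeasurable (by fun_prop)
  · refine (ae_restrict_iff' measurableSet_Ioc).2 (ae_of_all _ fun s hs => ?_)
    have h3 : 0 ≤ t - s := sub_nonneg.2 hs.2
    have h4 := hs.1
    have : |mittagLeffler a c (-σ * s ^ a)| ≤ mittagLeffler a c (|σ| * t ^ a) := by
      refine abs_mittagLeffler_le ha hc ?_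
      rw [abs_mul, abs_neg, abs_of_pos (Real.rpow_pos_of_pos hs.1 a)]
      gcongr
      exact hs.2
    unfold mlKernel
    rw [norm_mul, norm_mul, Real.norm_eq_abs, Real.norm_eq_abs, Real.norm_eq_abs,
      abs_of_nonneg (by positivity : 0 ≤ (t - s) ^ (b - 1) / Real.Gamma b),
      abs_of_nonneg (by positivity : 0 ≤ s ^ (c - 1))]
    calc (t - s) ^ (b - 1) / Real.Gamma b * (s ^ (c - 1) * |mittagLeffler a c (-σ * s ^ a)|)
        ≤ (t - s) ^ (b - 1) / Real.Gamma b *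
          (s ^ (c - 1) * mittagLeffler a c (|σ| * t ^ a)) := by gcongr
      _ = _ := by ring

/-- `e_1 + σ e_{a+1} = 1`. -/
theorem mlKernel_one_add {a : ℝ} (ha : 1 ≤ a) (σ : ℝ) {t : ℝ} (ht : 0 < t) :
    mlKernel a 1 σ t + σ * mlKernel a (a + 1) σ t = 1 := by
  have h1 := (hasSum_nat_add_iff' 1).2 (mlKernel_hasSum ha zero_le_one σ ht)
  have h2 := (mlKernel_hasSum ha (by linarith : 0 ≤ a + 1) σ ht).mul_left (-σ)
  have h3 := h1.unique (h2.congr_fun fun r => ?_)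
  · simp at h3
    linarith
  · push_cast
    rw [show a * (r + 1 : ℝ) + 1 = a * r + (a + 1) by ring]
    ring

/-! ### The Bromwich integral for `1 / Γ` -/

theorem integrableOn_rpow_mul_cexp {w : ℝ} (hw : 0 < w) {s : ℂ} (hs : 0 < s.re) :
    IntegrableOn (fun t : ℝ => ((t ^ (w - 1) : ℝ) : ℂ) * Complex.exp (-(s * t))) (Ioi 0) := by
  have h := integrableOn_rpow_mul_exp_neg_mul_rpow (by linarith : -1 < w - 1) one_pos hs
  refine Integrable.mono' h (by fun_prop) ?_
  refine (ae_restrict_iff' measurableSet_Ioi).2 (ae_of_all _ fun t ht => ?_)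
  rw [norm_mul, Complex.norm_real, Complex.norm_exp, Real.norm_eq_abs,
    abs_of_pos (Real.rpow_pos_of_pos ht _)]
  simp

/-- Integration by parts in the Laplace integral of `t^w`. -/
theorem mul_laplace_rpow {w : ℝ} (hw : 0 < w) {s : ℂ} (hs : 0 < s.re) :
    s * ∫ t in Ioi (0 : ℝ), ((t ^ w : ℝ) : ℂ) * Complex.exp (-(s * t)) =
      w * ∫ t in Ioi (0 : ℝ), ((t ^ (w - 1) : ℝ) : ℂ) * Complex.exp (-(s * t)) := by
  have hi1 := integrableOn_rpow_mul_cexp hw hs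
  have hi2 := integrableOn_rpow_mul_cexp (by linarith : 0 < w + 1) hs
  rw [add_sub_cancel_right] at hi2
  have key : ∫ t in Ioi (0 : ℝ), ((w : ℂ) * (((t ^ (w - 1) : ℝ) : ℂ) * Complex.exp (-(s * t))) -
      s * (((t ^ w : ℝ) : ℂ) * Complex.exp (-(s * t)))) = 0 - 0 := by
    refine (integral_Ioi_of_hasDerivAt_of_tendsto
      (f := fun t : ℝ => ((t ^ w : ℝ) : ℂ) * Complex.exp (-(s * t))) (a := 0) (m := 0)
      ?_ (fun t ht => ?_) ((hi1.const_mul _).sub (hi2.const_mul _)) ?_).trans ?_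
    · refine ContinuousAt.continuousWithinAt ?_
      have : ContinuousAt (fun t : ℝ => t ^ w) 0 := Real.continuousAt_rpow_const _ _ (Or.inr hw.le)
      exact (Complex.continuous_ofReal.continuousAt.comp this).mul (by fun_prop)
    · rw [Pi.sub_apply]
      have h1 := (Real.hasDerivAt_rpow_const (x := t) (p := w) (Or.inl (ne_of_gt ht))).ofReal_comp
      have h2 : HasDerivAt (fun t : ℝ => Complex.exp (-(s * t)))
          (Complex.exp (-(s * t)) * (-(s * 1))) t :=
        (((Complex.ofRealCLM.hasDerivAt (x := t)).const_mul s).neg).cexp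
      refine (h1.mul h2).congr_deriv ?_
      push_cast
      ring
    · rw [tendsto_zero_iff_norm_tendsto_zero]
      refine (tendsto_rpow_mul_exp_neg_mul_atTop_nhds_zero w s.re hs).congr' ?_
      filter_upwards [eventually_gt_atTop 0] with t ht
      rw [norm_mul, Complex.norm_real, Complex.norm_exp, Real.norm_eq_abs,
        abs_of_pos (Real.rpow_pos_of_pos ht _)]
      simp
    · simp [Real.zero_rpow hw.ne']
  rw [integral_sub (hi1.const_mul _) (hi2.const_mul _), integral_const_mul,
    integral_const_mul] at key
  linear_combination -key

theorem hasDerivAt_laplace_rpow {w : ℝ} (hw : 0 < w) {s : ℂ} (hs : 0 < s.re) :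
    HasDerivAt (fun s : ℂ => ∫ t in Ioi (0 : ℝ), ((t ^ (w - 1) : ℝ) : ℂ) * Complex.exp (-(s * t)))
      (-∫ t in Ioi (0 : ℝ), ((t ^ w : ℝ) : ℂ) * Complex.exp (-(s * t))) s := by
  have hb := integrableOn_rpow_mul_exp_neg_mul_rpow (by linarith : -1 < w) one_pos (half_pos hs)
  have h := (hasDerivAt_integral_of_dominated_loc_of_deriv_le (𝕜 := ℂ)
    (μ := volume.restrict (Ioi (0 : ℝ))) (x₀ := s) (s := Metric.ball s (s.re / 2))
    (F := fun (s : ℂ) (t : ℝ) => ((t ^ (w - 1) : ℝ) : ℂ) * Complex.exp (-(s * t)))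
    (F' := fun (s : ℂ) (t : ℝ) => -(((t ^ w : ℝ) : ℂ) * Complex.exp (-(s * t))))
    (Metric.ball_mem_nhds _ (half_pos hs)) (Eventually.of_forall fun z => by fun_prop)
    (integrableOn_rpow_mul_cexp hw hs) (by fun_prop)
    (bound := fun t => t ^ w * Real.exp (-(s.re / 2) * t ^ (1 : ℝ))) ?_ hb ?_).2
  · rwa [integral_neg] at h
  · refine (ae_restrict_iff' measurableSet_Ioi).2 (ae_of_all _ fun t ht z hz => ?_)
    rw [norm_neg, norm_mul, Complex.norm_real, Complex.norm_exp, Real.norm_eq_abs,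
      abs_of_pos (Real.rpow_pos_of_pos ht _), Real.rpow_one]
    have h1 : |(z - s).re| < s.re / 2 :=
      (Complex.abs_re_le_norm _).trans_lt (by rwa [← dist_eq_norm])
    have h2 : s.re / 2 < z.re := by
      rw [Complex.sub_re] at h1
      linarith [(abs_lt.1 h1).1]
    have h3 : 0 < t := ht
    gcongr
    simp only [Complex.neg_re, Complex.mul_re, Complex.ofReal_re, Complex.ofReal_im]
    nlinarith
  · refine (ae_restrict_iff' measurableSet_Ioi).2 (ae_of_all _ fun t ht z hz => ?_)
    have h2 : HasDerivAt (fun z : ℂ => Complex.exp (-(z * t)))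
        (Complex.exp (-(z * t)) * (-(1 * t))) z :=
      (((hasDerivAt_id z).mul_const (t : ℂ)).neg).cexp
    refine (h2.const_mul _).congr_deriv ?_
    have : t ^ w = t ^ (w - 1) * t := by
      rw [← Real.rpow_add_one (ne_of_gt ht), sub_add_cancel]
    rw [this]
    push_cast
    ring

/-- The Laplace transform of `t^{w-1}`, at complex arguments in the right half-plane: the function
`s^w ∫ t^{w-1} e^{-st} dt` has zero derivative there and equals `Γ(w)` at `s = 1`. -/
theorem laplace_rpow {w : ℝ} (hw : 0 < w) {s : ℂ} (hs : 0 < s.re) :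
    ∫ t in Ioi (0 : ℝ), ((t ^ (w - 1) : ℝ) : ℂ) * Complex.exp (-(s * t)) =
      Real.Gamma w * s ^ (-w : ℂ) := by
  set L := fun s : ℂ => ∫ t in Ioi (0 : ℝ), ((t ^ (w - 1) : ℝ) : ℂ) * Complex.exp (-(s * t)) with hL
  have hd : ∀ z : ℂ, 0 < z.re → HasDerivAt (fun z => z ^ (w : ℂ) * L z) 0 z := fun z hz => by
    have hz0 : z ≠ 0 := fun h => by simp [h] at hz
    have h1 := Complex.hasStrictDerivAt_cpow_const (x := z) (c := (w : ℂ)) (Or.inl hz)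
    refine (h1.hasDerivAt.mul (hasDerivAt_laplace_rpow hw hz)).congr_deriv ?_
    have h2 := mul_laplace_rpow hw hz
    rw [Complex.cpow_sub _ _ hz0, Complex.cpow_one]
    field_simp
    linear_combination -(z ^ (w : ℂ)) * h2
  have hconst := (isOpen_lt continuous_const Complex.continuous_re).is_const_of_deriv_eq_zero
    (s := {z : ℂ | 0 < z.re}) (convex_halfSpace_re_gt 0).isPreconnected
    (f := fun z => z ^ (w : ℂ) * L z)
    (fun z hz => (hd z hz).differentiableAt.differentiableWithinAt) (fun z hz => (hd z hz).deriv)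
    hs (show (0 : ℝ) < (1 : ℂ).re by simp)
  have h1 : L 1 = Real.Gamma w := by
    rw [Real.Gamma_eq_integral hw, hL, ← integral_complex_ofReal]
    refine setIntegral_congr_fun measurableSet_Ioi fun t _ => ?_
    push_cast
    rw [one_mul, mul_comm]
  have hs0 : s ≠ 0 := fun h => by simp [h] at hs
  simp only [Complex.one_cpow, one_mul, h1] at hconst
  change L s = _
  rw [Complex.cpow_neg, ← hconst]
  have : s ^ (w : ℂ) ≠ 0 := by simp [Complex.cpow_eq_zero_iff, hs0]
  field_simp

theorem norm_add_mul_I_ge {c : ℝ} (hc : 1 ≤ c) (y : ℝ) :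
    1 + ‖y‖ ^ 2 ≤ ‖(c : ℂ) + y * Complex.I‖ ^ 2 := by
  rw [Complex.sq_norm, Complex.normSq_add_mul_I, Real.norm_eq_abs, sq_abs]
  nlinarith

theorem norm_add_mul_I_rpow_le {c w : ℝ} (hc : 1 ≤ c) (hw : 0 ≤ w) (y : ℝ) :
    ‖(c : ℂ) + y * Complex.I‖ ^ (-w) ≤ (1 + ‖y‖ ^ 2) ^ (-w / 2) := by
  have h := norm_add_mul_I_ge hc y
  calc ‖(c : ℂ) + y * Complex.I‖ ^ (-w) = (‖(c : ℂ) + y * Complex.I‖ ^ 2) ^ (-w / 2) := by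
        rw [← Real.rpow_natCast, ← Real.rpow_mul (norm_nonneg _)]
        congr 1
        push_cast
        ring
    _ ≤ _ := Real.rpow_le_rpow_of_nonpos (by positivity) h (by linarith)

theorem integrable_one_add_sq_rpow {w : ℝ} (hw : 1 < w) :
    Integrable fun y : ℝ => (1 + ‖y‖ ^ 2) ^ (-w / 2) :=
  integrable_rpow_neg_one_add_norm_sq (by simpa using hw)

theorem integrable_of_norm_le_rpow {c w M : ℝ} (hc : 1 ≤ c) (hw : 1 < w) {F : ℝ → ℂ}
    (hF : AEStronglyMeasurable F) (hM : 0 ≤ M)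
    (hb : ∀ y : ℝ, ‖F y‖ ≤ M * ‖(c : ℂ) + y * Complex.I‖ ^ (-w)) : Integrable F :=
  ((integrable_one_add_sq_rpow hw).const_mul M).mono' hF
    (ae_of_all _ fun y => (hb y).trans
      (mul_le_mul_of_nonneg_left (norm_add_mul_I_rpow_le hc (by linarith) y) hM))

/-- The Bromwich integral for the reciprocal Gamma function, from Fourier inversion of
`t ↦ t^{w-1} e^{-ct}` at `t = 1`. -/
theorem integral_exp_mul_cpow_neg {c w : ℝ} (hc : 1 ≤ c) (hw : 1 < w) :
    ∫ y : ℝ, Complex.exp (c + y * Complex.I) * ((c : ℂ) + y * Complex.I) ^ (-w : ℂ) =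
      2 * Real.pi / Real.Gamma w := by
  have hc0 : 0 < c := by linarith
  have hw0 : 0 < w := by linarith
  have hG := Real.Gamma_pos_of_pos hw0
  set h : ℝ → ℂ := fun t => (((max t 0) ^ (w - 1) : ℝ) : ℂ) * Complex.exp (-(c * t)) with hh
  have hcont : Continuous h := by
    have : Continuous fun t : ℝ => (max t 0) ^ (w - 1) :=
      (Real.continuous_rpow_const (by linarith)).comp (by fun_prop)
    have := Complex.continuous_ofReal.comp this
    exact this.mul (by fun_prop)
  have hind : ∀ e : ℝ → ℂ, (fun t => e t * h t) =
      indicator (Ioi 0) fun t => e t * (((t ^ (w - 1) : ℝ) : ℂ) * Complex.exp (-(c * t))) :=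
    fun e => by
      funext t
      by_cases ht : 0 < t
      · rw [indicator_of_mem (mem_Ioi.2 ht), hh]
        simp only [max_eq_left ht.le]
      · rw [indicator_of_notMem (by simpa using ht), hh]
        simp only [max_eq_right (not_lt.1 ht), Real.zero_rpow (by linarith : w - 1 ≠ 0)]
        simp
  have hint : Integrable h := by
    have := hind (fun _ => 1)
    simp only [one_mul] at this
    change Integrable fun t => h t
    rw [this, integrable_indicator_iff measurableSet_Ioi]
    exact integrableOn_rpow_mul_cexp hw0 (s := (c : ℂ)) (by simpa)
  have hF : ∀ ξ : ℝ, FourierTransform.fourier h ξ =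
      Real.Gamma w * ((c : ℂ) + ((2 * Real.pi * ξ : ℝ) : ℂ) * Complex.I) ^ (-w : ℂ) := fun ξ => by
    rw [Real.fourier_eq']
    simp only [smul_eq_mul]
    rw [hind, integral_indicator measurableSet_Ioi, ← laplace_rpow hw0 (by simpa)]
    refine setIntegral_congr_fun measurableSet_Ioi fun t _ => ?_
    rw [mul_left_comm, ← Complex.exp_add]
    congr 2
    simp
    ring
  have hmeas : ∀ u : ℝ, Continuous fun y : ℝ =>
      ((c : ℂ) + ((u * y : ℝ) : ℂ) * Complex.I) ^ (-w : ℂ) := fun u => by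
    refine Continuous.cpow (by fun_prop) continuous_const (fun y => Or.inl ?_)
    simpa
  have hG1 : Integrable fun y : ℝ => ((c : ℂ) + (y : ℂ) * Complex.I) ^ (-w : ℂ) := by
    refine integrable_of_norm_le_rpow hc hw (M := 1) ?_ zero_le_one fun y => ?_
    · simpa using (hmeas 1).aestronglyMeasurable
    · rw [one_mul, ← Complex.ofReal_neg, Complex.norm_cpow_real]
  have hFint : Integrable (FourierTransform.fourier h) := by
    have : FourierTransform.fourier h = fun ξ : ℝ => (Real.Gamma w : ℂ) *
      ((c : ℂ) + ((2 * Real.pi * ξ : ℝ) : ℂ) * Complex.I) ^ (-w : ℂ) := funext hF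
    rw [this]
    exact (hG1.comp_mul_left' (by positivity : (2 * Real.pi) ≠ 0)).const_mul _
  have hinv := congrFun (hcont.fourierInv_fourier_eq hint hFint) 1
  rw [Real.fourierInv_eq'] at hinv
  simp only [smul_eq_mul, hF] at hinv
  have hsub := Measure.integral_comp_mul_left (fun y : ℝ =>
    Complex.exp (c + y * Complex.I) * ((c : ℂ) + y * Complex.I) ^ (-w : ℂ)) (2 * Real.pi)
  have h1 : h 1 = Complex.exp (-c) := by simp [hh]
  have h2 : ∫ ξ : ℝ, Complex.exp (c + ((2 * Real.pi * ξ : ℝ) : ℂ) * Complex.I) *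
      ((c : ℂ) + ((2 * Real.pi * ξ : ℝ) : ℂ) * Complex.I) ^ (-w : ℂ) =
      (Real.Gamma w : ℂ)⁻¹ * Complex.exp c * h 1 := by
    rw [← hinv, ← integral_const_mul]
    congr 1
    funext ξ
    have : (Real.Gamma w : ℂ) ≠ 0 := by exact_mod_cast hG.ne'
    rw [Complex.exp_add]
    simp only [RCLike.inner_apply, conj_trivial, one_mul]
    field_simp
  rw [h2, h1, mul_assoc, ← Complex.exp_add, add_neg_cancel, Complex.exp_zero, mul_one,
    abs_of_pos (by positivity), Complex.real_smul] at hsub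
  have hpi : (Real.pi : ℂ) ≠ 0 := by exact_mod_cast Real.pi_ne_zero
  push_cast at hsub
  rw [div_eq_mul_inv, hsub, mul_inv_cancel_left₀ (by simp)]

/-! ### Uniform bounds on the negative half-line -/

/-- Moving a vertical line of integration within `Re s ≥ 1`. -/
theorem integral_vertical_line_eq {F : ℂ → ℂ} {w M : ℝ} (hw : 1 < w) (hM : 0 ≤ M)
    (hF : DifferentiableOn ℂ F {s | 0 < s.re})
    (hb : ∀ s : ℂ, 0 < s.re → ‖F s‖ ≤ M * Real.exp s.re * ‖s‖ ^ (-w)) {c : ℝ} (hc : 1 ≤ c) :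
    ∫ y : ℝ, F (c + y * Complex.I) = ∫ y : ℝ, F ((1 : ℝ) + y * Complex.I) := by
  have hint : ∀ d : ℝ, 1 ≤ d → Integrable fun y : ℝ => F (d + y * Complex.I) := fun d hd => by
    refine integrable_of_norm_le_rpow hd hw (M := M * Real.exp d) ?_ (by positivity) fun y => ?_
    · have : Continuous fun y : ℝ => F (d + y * Complex.I) :=
        hF.continuousOn.comp_continuous (by fun_prop) fun y => by simp; linarith
      exact this.aestronglyMeasurable
    · simpa using hb (d + y * Complex.I) (by simp; linarith)
  have hlim : ∀ d : ℝ, 1 ≤ d → Tendsto (fun T : ℝ => ∫ y in (-T)..T, F (d + y * Complex.I)) atTop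
      (𝓝 (∫ y : ℝ, F (d + y * Complex.I))) := fun d hd =>
    intervalIntegral_tendsto_integral (hint d hd) tendsto_neg_atTop_atBot tendsto_id
  have hhor : ∀ T : ℝ, 0 < |T| → ‖∫ x in (1 : ℝ)..c, F (x + T * Complex.I)‖ ≤
      M * Real.exp c * |T| ^ (-w) * |c - 1| := fun T hT => by
    refine intervalIntegral.norm_integral_le_of_norm_le_const fun x hx => ?_
    rw [uIoc_of_le hc] at hx
    have hx0 : 0 < x := by linarith [hx.1]
    refine (hb _ (by simpa)).trans ?_
    have h1 : |T| ≤ ‖(x : ℂ) + T * Complex.I‖ := by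
      simpa using Complex.abs_im_le_norm ((x : ℂ) + T * Complex.I)
    have h2 : ‖(x : ℂ) + T * Complex.I‖ ^ (-w) ≤ |T| ^ (-w) :=
      Real.rpow_le_rpow_of_nonpos hT h1 (by linarith)
    have h3 : ((x : ℂ) + T * Complex.I).re ≤ c := by simpa using hx.2
    gcongr
  have hzero : Tendsto (fun T : ℝ => M * Real.exp c * T ^ (-w) * |c - 1|) atTop (𝓝 0) := by
    have := ((tendsto_rpow_neg_atTop (by linarith : 0 < w)).const_mul (M * Real.exp c)).mul_const
      |c - 1|
    simpa using this
  -- Cauchy's theorem on the rectangle with corners `1 - iT` and `c + iT`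
  have hrect : ∀ T : ℝ, 0 < T → ‖(∫ y in (-T)..T, F (c + y * Complex.I)) -
      ∫ y in (-T)..T, F ((1 : ℝ) + y * Complex.I)‖ ≤
      M * Real.exp c * T ^ (-w) * |c - 1| + M * Real.exp c * T ^ (-w) * |c - 1| := fun T hT => by
    have h := Complex.integral_boundary_rect_eq_zero_of_differentiableOn F
      ⟨1, -T⟩ ⟨c, T⟩ (hF.mono fun z hz => by
        have := (Complex.mem_reProdIm.1 hz).1
        rw [uIcc_of_le hc] at this
        exact lt_of_lt_of_le one_pos this.1)
    simp only [smul_eq_mul] at h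
    have hT' := hhor T (by simpa using hT.ne')
    have hT'' := hhor (-T) (by simpa using hT.ne')
    rw [abs_neg] at hT''
    rw [abs_of_pos hT] at hT' hT''
    have heq : (∫ y in (-T)..T, F (c + y * Complex.I)) - ∫ y in (-T)..T, F ((1 : ℝ) + y * Complex.I)
        = -Complex.I * ((∫ x in (1 : ℝ)..c, F (x + T * Complex.I)) -
          ∫ x in (1 : ℝ)..c, F (x + (-T : ℝ) * Complex.I)) := by
      linear_combination (-Complex.I) * h + ((∫ y in (-T)..T, F (c + y * Complex.I)) -
        ∫ y in (-T)..T, F ((1 : ℝ) + y * Complex.I)) * Complex.I_mul_I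
    rw [heq, norm_mul, norm_neg, Complex.norm_I, one_mul]
    exact (norm_sub_le _ _).trans (add_le_add hT' hT'')
  have hdiff := (hlim c hc).sub (hlim 1 le_rfl)
  have hz : Tendsto (fun T : ℝ => (∫ y in (-T)..T, F (c + y * Complex.I)) -
      ∫ y in (-T)..T, F ((1 : ℝ) + y * Complex.I)) atTop (𝓝 0) := by
    refine squeeze_zero_norm' ?_ (by simpa using hzero.add hzero)
    filter_upwards [eventually_gt_atTop 0] with T hT using hrect T hT
  exact sub_eq_zero.1 (tendsto_nhds_unique hdiff hz)

/-- For `1 < a < 2` and `Re s > 0` the argument of `s^a` stays away from `π`, so `s^a` stays away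
from the negative half-line. -/
theorem sin_mul_le_norm_cpow_add {a : ℝ} (ha : 1 < a ∧ a < 2) {s : ℂ} (hs : 0 < s.re) {y : ℝ}
    (hy : 0 ≤ y) :
    Real.sin (a * (Real.pi / 2)) * ‖s‖ ^ a ≤ ‖s ^ (a : ℂ) + y‖ ∧
      Real.sin (a * (Real.pi / 2)) * y ≤ ‖s ^ (a : ℂ) + y‖ := by
  set θ := a * (Real.pi / 2) with hθ
  have hpi := Real.pi_pos
  have hθ0 : 0 ≤ θ := by have := ha.1; positivity
  have hθ1 : θ ≤ Real.pi := by nlinarith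
  have harg : |Complex.arg s| < Real.pi / 2 := Complex.abs_arg_lt_pi_div_two_iff.2 (Or.inl hs)
  have hcos : Real.cos θ ≤ Real.cos (Complex.arg s * a) := by
    rw [← Real.cos_abs (Complex.arg s * a), abs_mul, abs_of_pos (by linarith : 0 < a)]
    refine Real.cos_le_cos_of_nonneg_of_le_pi (by have := ha.1; positivity) hθ1 ?_
    rw [hθ, mul_comm]
    gcongr
    linarith
  have hR : 0 ≤ ‖s‖ ^ a := by positivity
  have hsc := Real.sin_sq_add_cos_sq θ
  have hsq : ‖s ^ (a : ℂ) + y‖ ^ 2 =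
      (‖s‖ ^ a) ^ 2 + 2 * (‖s‖ ^ a * y) * Real.cos (Complex.arg s * a) + y ^ 2 := by
    rw [Complex.sq_norm, Complex.normSq_apply]
    simp only [Complex.add_re, Complex.add_im, Complex.ofReal_re, Complex.ofReal_im,
      Complex.cpow_ofReal_re, Complex.cpow_ofReal_im]
    linear_combination (‖s‖ ^ a) ^ 2 * Real.sin_sq_add_cos_sq (Complex.arg s * a)
  have hge : (‖s‖ ^ a) ^ 2 + 2 * (‖s‖ ^ a * y) * Real.cos θ + y ^ 2 ≤ ‖s ^ (a : ℂ) + y‖ ^ 2 := by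
    rw [hsq]
    gcongr
  constructor
  · refine le_of_sq_le_sq ?_ (norm_nonneg _)
    nlinarith [sq_nonneg (y + ‖s‖ ^ a * Real.cos θ)]
  · refine le_of_sq_le_sq ?_ (norm_nonneg _)
    nlinarith [sq_nonneg (‖s‖ ^ a + y * Real.cos θ)]

/-- The Laplace-type symbol in `E_{a,a-1}(-y) = (2π)^{-1} ∫ mlSymbol a y (c + iη) dη`. It is
`e^s` times the Laplace transform of `t^{a-1} E_{a,a-1}(-y t^a)`. -/
noncomputable def mlSymbol (a y : ℝ) (s : ℂ) : ℂ :=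
  Complex.exp s * ((a - 1) / (s ^ (a : ℂ) + y) - a * y / (s ^ (a : ℂ) + y) ^ 2)

theorem cpow_add_ne_zero {a : ℝ} (ha : 1 < a ∧ a < 2) {s : ℂ} (hs : 0 < s.re) {y : ℝ}
    (hy : 0 ≤ y) : s ^ (a : ℂ) + y ≠ 0 := by
  have hpi := Real.pi_pos
  have hκ : 0 < Real.sin (a * (Real.pi / 2)) :=
    Real.sin_pos_of_pos_of_lt_pi (by have := ha.1; positivity) (by nlinarith [ha.2])
  have hs0 : s ≠ 0 := fun h => by simp [h] at hs
  have : 0 < ‖s‖ := norm_pos_iff.2 hs0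
  exact norm_pos_iff.1 (lt_of_lt_of_le (by positivity) (sin_mul_le_norm_cpow_add ha hs hy).1)

theorem differentiableOn_mlSymbol {a y : ℝ} (ha : 1 < a ∧ a < 2) (hy : 0 ≤ y) :
    DifferentiableOn ℂ (mlSymbol a y) {s | 0 < s.re} := by
  intro s hs
  have h1 : DifferentiableAt ℂ (fun s : ℂ => s ^ (a : ℂ) + y) s :=
    (Complex.hasStrictDerivAt_cpow_const (Or.inl hs)).hasDerivAt.differentiableAt.add_const _
  have h2 := cpow_add_ne_zero ha hs hy
  unfold mlSymbol
  refine DifferentiableAt.differentiableWithinAt ?_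
  exact Complex.differentiableAt_exp.mul (((differentiableAt_const _).div h1 h2).sub
    ((differentiableAt_const _).div (h1.pow 2) (pow_ne_zero 2 h2)))

theorem norm_mlSymbol_le {a y : ℝ} (ha : 1 < a ∧ a < 2) (hy : 0 ≤ y) {s : ℂ} (hs : 0 < s.re) :
    ‖mlSymbol a y s‖ ≤ ((a - 1) / Real.sin (a * (Real.pi / 2)) +
      a / Real.sin (a * (Real.pi / 2)) ^ 2) * Real.exp s.re * ‖s‖ ^ (-a) := by
  have hpi := Real.pi_pos
  set κ := Real.sin (a * (Real.pi / 2)) with hκd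
  have hκ : 0 < κ :=
    Real.sin_pos_of_pos_of_lt_pi (by have := ha.1; positivity) (by nlinarith [ha.2])
  have hs0 : s ≠ 0 := fun h => by simp [h] at hs
  have hn : 0 < ‖s‖ ^ a := Real.rpow_pos_of_pos (norm_pos_iff.2 hs0) _
  obtain ⟨h1, h2⟩ := sin_mul_le_norm_cpow_add ha hs hy
  rw [← hκd] at h1 h2
  set D := ‖s ^ (a : ℂ) + y‖ with hD
  have hDpos : 0 < D := lt_of_lt_of_le (by positivity) h1
  have h3 : ‖((a : ℂ) - 1) / (s ^ (a : ℂ) + y)‖ ≤ (a - 1) / (κ * ‖s‖ ^ a) := by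
    rw [norm_div, ← hD, ← Complex.ofReal_one, ← Complex.ofReal_sub, Complex.norm_real,
      Real.norm_eq_abs, abs_of_pos (by linarith : 0 < a - 1)]
    have := ha.1
    gcongr
  have h4 : ‖(a : ℂ) * y / (s ^ (a : ℂ) + y) ^ 2‖ ≤ a / (κ ^ 2 * ‖s‖ ^ a) := by
    rw [norm_div, norm_pow, ← hD, ← Complex.ofReal_mul, Complex.norm_real,
      Real.norm_eq_abs, abs_of_nonneg (by have := ha.1; positivity : 0 ≤ a * y),
      div_le_div_iff₀ (by positivity) (by positivity)]
    have : κ * y * (κ * ‖s‖ ^ a) ≤ D * D := mul_le_mul h2 h1 (by positivity) hDpos.le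
    have ha0 : 0 < a := by linarith
    nlinarith
  unfold mlSymbol
  rw [norm_mul, Complex.norm_exp, Real.rpow_neg (norm_nonneg _)]
  calc Real.exp s.re * ‖((a : ℂ) - 1) / (s ^ (a : ℂ) + y) - a * y / (s ^ (a : ℂ) + y) ^ 2‖
      ≤ Real.exp s.re * ((a - 1) / (κ * ‖s‖ ^ a) + a / (κ ^ 2 * ‖s‖ ^ a)) := by
        gcongr
        exact (norm_sub_le _ _).trans (add_le_add h3 h4)
    _ = _ := by field_simp

/-- The expansion of the symbol in powers of `-y / s^a`. The factor `a r + a - 1` is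
`Γ(a r + a) / Γ(a r + a - 1)`. -/
theorem hasSum_mlSymbol {a y : ℝ} {s : ℂ} (hs : s ≠ 0) (h : y < ‖s‖ ^ a) (hy : 0 ≤ y) :
    HasSum (fun r : ℕ => (((a * r + a - 1) * (-y) ^ r : ℝ) : ℂ) *
      (Complex.exp s * s ^ (-((a * r + a : ℝ) : ℂ)))) (mlSymbol a y s) := by
  set q : ℂ := -y / s ^ (a : ℂ) with hq
  have hsa : s ^ (a : ℂ) ≠ 0 := by simp [Complex.cpow_eq_zero_iff, hs]
  have hn : 0 < ‖s‖ ^ a := Real.rpow_pos_of_pos (norm_pos_iff.2 hs) _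
  have hq1 : ‖q‖ < 1 := by
    rw [hq, norm_div, norm_neg, Complex.norm_real, Complex.norm_cpow_real, div_lt_one hn,
      Real.norm_eq_abs, abs_of_nonneg hy]
    exact h
  have hden : s ^ (a : ℂ) + y ≠ 0 := fun h0 => by
    have : ‖s ^ (a : ℂ)‖ = ‖(y : ℂ)‖ := by rw [eq_neg_of_add_eq_zero_left h0, norm_neg]
    rw [Complex.norm_cpow_real, Complex.norm_real, Real.norm_eq_abs, abs_of_nonneg hy] at this
    linarith
  have h1 := ((hasSum_geometric_of_norm_lt_one hq1).mul_left ((a : ℂ) - 1)).add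
    ((hasSum_coe_mul_geometric_of_norm_lt_one hq1).mul_left (a : ℂ))
  have h2 := h1.mul_left (Complex.exp s * (s ^ (a : ℂ))⁻¹)
  have hval : Complex.exp s * (s ^ (a : ℂ))⁻¹ * (((a : ℂ) - 1) * (1 - q)⁻¹ +
      a * (q / (1 - q) ^ 2)) = mlSymbol a y s := by
    have h1q : 1 - q = (s ^ (a : ℂ) + y) / s ^ (a : ℂ) := by
      rw [hq]
      field_simp
      ring
    rw [h1q, mlSymbol, hq]
    field_simp
    ring
  rw [hval] at h2
  refine h2.congr_fun fun r => ?_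
  have hp : s ^ (-((a * r + a : ℝ) : ℂ)) = ((s ^ (a : ℂ)) ^ r)⁻¹ * (s ^ (a : ℂ))⁻¹ := by
    rw [Complex.cpow_neg]
    push_cast
    rw [Complex.cpow_add _ _ hs, mul_inv, Complex.cpow_mul_nat]
  rw [hp, hq, div_pow]
  push_cast
  field_simp
  ring

/-- Laplace inversion of the Mittag-Leffler function `E_{a,a-1}`, on a line far to the right. -/
theorem integral_mlSymbol {a y : ℝ} (ha : 1 < a) (hy : 0 ≤ y) {c : ℝ} (hc : 1 ≤ c)
    (hyc : y < c) :
    ∫ η : ℝ, mlSymbol a y (c + η * Complex.I) =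
      ((2 * Real.pi * mittagLeffler a (a - 1) (-y) : ℝ) : ℂ) := by
  have hc0 : 0 < c := by linarith
  have hnorm : ∀ η : ℝ, c ≤ ‖(c : ℂ) + η * Complex.I‖ := fun η => by
    simpa [abs_of_pos hc0] using Complex.abs_re_le_norm ((c : ℂ) + η * Complex.I)
  have hca : c ≤ c ^ a := by simpa using Real.rpow_le_rpow_of_exponent_le hc ha.le
  have hs0 : ∀ η : ℝ, (c : ℂ) + η * Complex.I ≠ 0 := fun η h => by
    have := hnorm η
    rw [h, norm_zero] at this
    linarith
  have hra : ∀ r : ℕ, 1 < a * r + a := fun r => by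
    have : 0 ≤ a * r := by positivity
    linarith
  set F : ℕ → ℝ → ℂ := fun r η => (((a * r + a - 1) * (-y) ^ r : ℝ) : ℂ) *
      (Complex.exp (c + η * Complex.I) * ((c : ℂ) + η * Complex.I) ^
        (-((a * r + a : ℝ) : ℂ))) with hF
  have hJ := integrable_one_add_sq_rpow ha
  set B : ℝ → ℝ := fun η => (1 + ‖η‖ ^ 2) ^ (-a / 2) with hB
  set u : ℕ → ℝ := fun r => (a * r + a - 1) * (y / c) ^ r * Real.exp c with hu
  have hbound : ∀ r η, ‖F r η‖ ≤ u r * B η := fun r η => by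
    have h1 : ‖(c : ℂ) + η * Complex.I‖ ^ (-(a * r + a)) ≤ (c ^ r)⁻¹ * B η := by
      have hsplit : -(a * r + a) = (-(a * r)) + (-a) := by ring
      rw [hsplit, Real.rpow_add (by linarith [hnorm η])]
      have h2 : ‖(c : ℂ) + η * Complex.I‖ ^ (-(a * r)) ≤ (c ^ r)⁻¹ := by
        calc _ ≤ c ^ (-(a * r)) := Real.rpow_le_rpow_of_nonpos hc0 (hnorm η)
              (by have : 0 ≤ a * r := by positivity
                  linarith)
          _ ≤ c ^ (-(r : ℝ)) := by
              refine Real.rpow_le_rpow_of_exponent_le hc ?_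
              have : (r : ℝ) ≤ a * r := le_mul_of_one_le_left (Nat.cast_nonneg r) ha.le
              linarith
          _ = _ := by rw [Real.rpow_neg hc0.le, Real.rpow_natCast]
      have h3 := norm_add_mul_I_rpow_le hc (by linarith : 0 ≤ a) η
      gcongr
    have h4 : 0 ≤ a * r + a - 1 := by linarith [hra r]
    simp only [hF, hu]
    rw [norm_mul, norm_mul, Complex.norm_exp, ← Complex.ofReal_neg, Complex.norm_cpow_real,
      Complex.norm_real, norm_mul, norm_pow, norm_neg, Real.norm_eq_abs, Real.norm_eq_abs,
      abs_of_nonneg h4, abs_of_nonneg hy]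
    have h5 : ((c : ℂ) + η * Complex.I).re = c := by simp
    rw [h5]
    calc _ ≤ (a * r + a - 1) * y ^ r * (Real.exp c * ((c ^ r)⁻¹ * B η)) := by gcongr
      _ = _ := by rw [div_pow]; ring
  have hmeas : ∀ r, AEStronglyMeasurable (F r) := fun r => by
    refine Continuous.aestronglyMeasurable ?_
    have : Continuous fun η : ℝ => ((c : ℂ) + η * Complex.I) ^ (-((a * r + a : ℝ) : ℂ)) := by
      refine Continuous.cpow (by fun_prop) continuous_const (fun y => Or.inl ?_)
      simpa
    fun_prop
  have hFint : ∀ r, Integrable (F r) := fun r =>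
    (hJ.const_mul (u r)).mono' (hmeas r) (ae_of_all _ (hbound r))
  have husum : Summable u := by
    have hq : ‖y / c‖ < 1 := by
      rw [Real.norm_eq_abs, abs_of_nonneg (by positivity), div_lt_one hc0]
      exact hyc
    have h1 := ((hasSum_coe_mul_geometric_of_norm_lt_one hq).summable.mul_left a).add
      ((hasSum_geometric_of_norm_lt_one hq).summable.mul_left (a - 1))
    refine (h1.mul_right (Real.exp c)).congr fun r => ?_
    simp only [hu]
    ring
  have hsum := hasSum_integral_of_summable_integral_norm hFint
    (Summable.of_nonneg_of_le (fun r => integral_nonneg fun η => norm_nonneg _) (fun r => by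
      refine (integral_mono (hFint r).norm (hJ.const_mul (u r)) (hbound r)).trans ?_
      rw [integral_const_mul]) (husum.mul_right (∫ η, B η)))
  have hpt : ∀ η : ℝ, ∑' r, F r η = mlSymbol a y (c + η * Complex.I) := fun η =>
    (hasSum_mlSymbol (hs0 η) (hyc.trans_le (hca.trans
      (Real.rpow_le_rpow hc0.le (hnorm η) (by linarith)))) hy).tsum_eq
  simp_rw [hpt] at hsum
  have hterm : ∀ r : ℕ, ∫ η, F r η =
      ((2 * Real.pi * ((-y) ^ r / Real.Gamma (a * r + (a - 1))) : ℝ) : ℂ) := fun r => by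
    simp only [hF]
    rw [integral_const_mul, integral_exp_mul_cpow_neg hc (hra r)]
    have h1 : Real.Gamma (a * r + a) = (a * r + (a - 1)) * Real.Gamma (a * r + (a - 1)) := by
      rw [← Real.Gamma_add_one (by linarith [hra r])]
      congr 1
      ring
    have h2 : a * r + (a - 1) ≠ 0 := by linarith [hra r]
    rw [h1, show a * (r : ℝ) + a - 1 = a * r + (a - 1) by ring]
    have h3 := (Gamma_nat_mul_add_pos (by linarith : 0 ≤ a) (by linarith : 0 < a - 1) r).ne'
    norm_cast
    field_simp
  simp_rw [hterm] at hsum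
  refine hsum.unique (Complex.hasSum_ofReal.2 ?_)
  exact (summable_mittagLeffler ha.le (by linarith) (-y)).hasSum.mul_left _

/-- `E_{a,a-1}` is bounded on the negative half-line. For `a < 2` the line of integration is moved
from `Re s = y + 1` to `Re s = 1`, where the bound for the symbol does not depend on `y`; at
`a = 2`, where that bound breaks down, the function is `cos √y`. -/
theorem exists_abs_mittagLeffler_sub_one_le {a : ℝ} (ha : 1 < a ∧ a ≤ 2) :
    ∃ C, ∀ y : ℝ, 0 ≤ y → |mittagLeffler a (a - 1) (-y)| ≤ C := by
  rcases ha.2.lt_or_eq with h2 | rfl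
  · have ha' : 1 < a ∧ a < 2 := ⟨ha.1, h2⟩
    set M := (a - 1) / Real.sin (a * (Real.pi / 2)) + a / Real.sin (a * (Real.pi / 2)) ^ 2 with hMd
    have hpi := Real.pi_pos
    have hM : 0 ≤ M := by
      have hκ : 0 < Real.sin (a * (Real.pi / 2)) :=
        Real.sin_pos_of_pos_of_lt_pi (by have := ha.1; positivity) (by nlinarith)
      have : 0 < a - 1 := by linarith [ha.1]
      have : 0 < a := by linarith
      positivity
    refine ⟨M * Real.exp 1 * ∫ η : ℝ, (1 + ‖η‖ ^ 2) ^ (-a / 2), fun y hy => ?_⟩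
    have h1 := integral_mlSymbol ha.1 hy (c := y + 1) (by linarith) (by linarith)
    rw [integral_vertical_line_eq ha.1 hM (differentiableOn_mlSymbol ha' hy)
      (fun s hs => norm_mlSymbol_le ha' hy hs) (by linarith)] at h1
    have h3 : |2 * Real.pi * mittagLeffler a (a - 1) (-y)| ≤
        M * Real.exp 1 * ∫ η : ℝ, (1 + ‖η‖ ^ 2) ^ (-a / 2) := by
      rw [← Real.norm_eq_abs, ← Complex.norm_real, ← h1, ← integral_const_mul]
      refine norm_integral_le_of_norm_le ((integrable_one_add_sq_rpow ha.1).const_mul _)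
        (ae_of_all _ fun η => ?_)
      refine (norm_mlSymbol_le ha' hy (by simp)).trans ?_
      have h4 := norm_add_mul_I_rpow_le le_rfl (by linarith [ha.1] : 0 ≤ a) η
      have h5 : (((1 : ℝ) : ℂ) + η * Complex.I).re = 1 := by simp
      rw [h5]
      gcongr
    refine le_trans ?_ h3
    rw [abs_mul, abs_of_pos (by positivity : 0 < 2 * Real.pi)]
    have : 1 ≤ 2 * Real.pi := by linarith [Real.pi_gt_three]
    exact le_mul_of_one_le_left (abs_nonneg _) this
  · refine ⟨1, fun y hy => ?_⟩
    have : mittagLeffler 2 (2 - 1) (-y) = Real.cos (Real.sqrt y) := by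
      rw [Real.cos_eq_tsum]
      refine tsum_congr fun r => ?_
      rw [show (2 : ℝ) * r + (2 - 1) = ((2 * r : ℕ) : ℝ) + 1 by push_cast; ring,
        Real.Gamma_nat_eq_factorial, pow_mul, Real.sq_sqrt hy, neg_pow]
    rw [this]
    exact Real.abs_cos_le_one _

/-- `E_{a,a}` is bounded on the negative half-line: `t^{a-1} E_{a,a}(-σ t^a)` is the primitive of
`t^{a-2} E_{a,a-1}(-σ t^a)`, used here at `t = 1`. -/
theorem exists_abs_mittagLeffler_self_le {a : ℝ} (ha : 1 < a ∧ a ≤ 2) :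
    ∃ C, ∀ y : ℝ, 0 ≤ y → |mittagLeffler a a (-y)| ≤ C := by
  obtain ⟨C, hC⟩ := exists_abs_mittagLeffler_sub_one_le ha
  have ha1 : 0 < a - 1 := by linarith [ha.1]
  have hi := (integrableOn_rpow_mul_rpow one_pos ha1 one_pos).const_mul C
  refine ⟨∫ s in Ioc (0 : ℝ) 1, C * ((1 - s) ^ ((1 : ℝ) - 1) * s ^ (a - 1 - 1)), fun y hy => ?_⟩
  have h := integral_rl_mlKernel ha.1.le one_pos ha1 y one_pos
  have h1 : mlKernel a (1 + (a - 1)) y 1 = mittagLeffler a a (-y) := by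
    simp [mlKernel]
  rw [← h1, ← h, ← Real.norm_eq_abs]
  refine norm_integral_le_of_norm_le hi ?_
  refine (ae_restrict_iff' measurableSet_Ioc).2 (ae_of_all _ fun s hs => ?_)
  have h3 := hs.1
  rw [sub_self, Real.rpow_zero, Real.Gamma_one, div_one, one_mul, one_mul, mlKernel, norm_mul,
    Real.norm_eq_abs, Real.norm_eq_abs, abs_of_pos (Real.rpow_pos_of_pos hs.1 _), mul_comm]
  gcongr
  rw [neg_mul]
  exact hC _ (by positivity)

/-! ### Fourier inversion, and Fubini on a strip -/

theorem fourier_eq_fourierT (h : ℝ → ℂ) (ξ : ℝ) :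
    FourierTransform.fourier h ξ =
      (Real.sqrt (2 * Real.pi) : ℂ) * fourierT h (-(2 * Real.pi * ξ)) := by
  have h0 : (Real.sqrt (2 * Real.pi) : ℂ) ≠ 0 := by
    have : 0 < Real.sqrt (2 * Real.pi) := Real.sqrt_pos.2 (by positivity)
    exact_mod_cast this.ne'
  rw [Real.fourier_eq', fourierT]
  push_cast
  rw [← mul_assoc, mul_one_div_cancel h0, one_mul]
  congr 1
  funext x
  rw [smul_eq_mul]
  congr 2
  simp
  ring

theorem integrable_exp_I_mul (k : ℝ) {h : ℝ → ℂ} (hh : Integrable h) :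
    Integrable fun x : ℝ => Complex.exp (Complex.I * (k : ℂ) * (x : ℂ)) * h x := by
  refine (hh.bdd_mul (c := 1) (by fun_prop) (ae_of_all _ fun x => ?_))
  rw [Complex.norm_exp]
  simp

theorem norm_exp_I_mul (k x : ℝ) : ‖Complex.exp (Complex.I * (k : ℂ) * (x : ℂ))‖ = 1 := by
  rw [Complex.norm_exp]
  simp

theorem norm_exp_neg_I_mul (k x : ℝ) :
    ‖Complex.exp (-(Complex.I * (k : ℂ) * (x : ℂ)))‖ = 1 := by
  rw [Complex.norm_exp]
  simp

theorem norm_fourierT_le (h : ℝ → ℂ) (k : ℝ) :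
    ‖fourierT h k‖ ≤ 1 / Real.sqrt (2 * Real.pi) * ∫ x, ‖h x‖ := by
  rw [fourierT, norm_mul, Complex.norm_real, Real.norm_eq_abs, abs_of_nonneg (by positivity)]
  gcongr
  refine (norm_integral_le_integral_norm _).trans_eq ?_
  congr 1
  funext x
  rw [norm_mul, norm_exp_I_mul, one_mul]

theorem continuous_fourierT {h : ℝ → ℂ} (hh : Integrable h) : Continuous (fourierT h) := by
  unfold fourierT
  refine continuous_const.mul (continuous_of_dominated (bound := fun x => ‖h x‖)
    (fun k => (integrable_exp_I_mul k hh).1) (fun k => ae_of_all _ fun x => ?_) hh.norm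
    (ae_of_all _ fun x => by fun_prop))
  rw [norm_mul, norm_exp_I_mul, one_mul]

theorem fourierT_sub {h₁ h₂ : ℝ → ℂ} (h1 : Integrable h₁) (h2 : Integrable h₂) (k : ℝ) :
    fourierT (fun x => h₁ x - h₂ x) k = fourierT h₁ k - fourierT h₂ k := by
  unfold fourierT
  simp_rw [mul_sub]
  rw [integral_sub (integrable_exp_I_mul k h1) (integrable_exp_I_mul k h2), mul_sub]

theorem fourierT_add {h₁ h₂ : ℝ → ℂ} (h1 : Integrable h₁) (h2 : Integrable h₂) (k : ℝ) :
    fourierT (fun x => h₁ x + h₂ x) k = fourierT h₁ k + fourierT h₂ k := by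
  unfold fourierT
  simp_rw [mul_add]
  rw [integral_add (integrable_exp_I_mul k h1) (integrable_exp_I_mul k h2), mul_add]

theorem fourierT_mul_const (h : ℝ → ℂ) (c : ℂ) (k : ℝ) :
    fourierT (fun x => h x * c) k = fourierT h k * c := by
  unfold fourierT
  simp_rw [← mul_assoc]
  rw [integral_mul_const, mul_assoc]

/-- Fourier inversion in the unitary normalization. -/
theorem eq_integral_fourierT {h : ℝ → ℂ} (hc : Continuous h) (hh : Integrable h)
    (hF : Integrable (fourierT h)) (x : ℝ) :
    h x = ((1 / Real.sqrt (2 * Real.pi) : ℝ) : ℂ) *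
      ∫ k : ℝ, Complex.exp (-(Complex.I * (k : ℂ) * (x : ℂ))) * fourierT h k := by
  have hpi := Real.pi_pos
  have hr : Real.sqrt (2 * Real.pi) ≠ 0 := (Real.sqrt_pos.2 (by positivity)).ne'
  have hF' : Integrable (FourierTransform.fourier h) := by
    have : FourierTransform.fourier h = fun ξ : ℝ => (Real.sqrt (2 * Real.pi) : ℂ) *
      fourierT h (-(2 * Real.pi) * ξ) := funext fun ξ => by rw [fourier_eq_fourierT, neg_mul]
    rw [this]
    exact (hF.comp_mul_left' (neg_ne_zero.2 (by positivity))).const_mul _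
  have hinv := congrFun (hc.fourierInv_fourier_eq hh hF') x
  have hsub := Measure.integral_comp_mul_left
    (fun k : ℝ => Complex.exp (-(Complex.I * (k : ℂ) * (x : ℂ))) * fourierT h k) (-(2 * Real.pi))
  rw [Real.fourierInv_eq'] at hinv
  have h2 : ∫ ξ : ℝ, Complex.exp (-(Complex.I * ((-(2 * Real.pi) * ξ : ℝ) : ℂ) * (x : ℂ))) *
      fourierT h (-(2 * Real.pi) * ξ) = ((Real.sqrt (2 * Real.pi))⁻¹ : ℂ) * h x := by
    rw [← hinv, ← integral_const_mul]
    congr 1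
    funext ξ
    have : (Real.sqrt (2 * Real.pi) : ℂ) ≠ 0 := by exact_mod_cast hr
    have hneg : -(2 * Real.pi) * ξ = -(2 * Real.pi * ξ) := by ring
    rw [fourier_eq_fourierT, smul_eq_mul, hneg, mul_left_comm, inv_mul_cancel_left₀ this]
    congr 2
    simp
    ring
  rw [h2, inv_neg, abs_neg, abs_of_pos (by positivity), Complex.real_smul] at hsub
  have hsq : (Real.sqrt (2 * Real.pi) : ℂ) * Real.sqrt (2 * Real.pi) = 2 * Real.pi := by
    exact_mod_cast Real.mul_self_sqrt (by positivity : 0 ≤ 2 * Real.pi)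
  have h0 : (Real.sqrt (2 * Real.pi) : ℂ) ≠ 0 := by exact_mod_cast hr
  have h1 : (2 * Real.pi : ℂ) ≠ 0 := by rw [← hsq]; exact mul_ne_zero h0 h0
  push_cast at hsub ⊢
  have h3 : h x = Real.sqrt (2 * Real.pi) * ((Real.sqrt (2 * Real.pi) : ℂ)⁻¹ * h x) := by
    field_simp
  rw [h3, hsub, ← hsq, mul_inv, mul_assoc, mul_inv_cancel_left₀ h0, one_div]

/-- The transform of the inverse transform. Only continuity of `h` is used to get equality at every
point. -/
theorem fourierT_integral_exp {h : ℝ → ℂ} (hc : Continuous h) (hh : Integrable h)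
    (hv : Integrable fun x : ℝ => ((1 / Real.sqrt (2 * Real.pi) : ℝ) : ℂ) *
      ∫ k : ℝ, Complex.exp (-(Complex.I * (k : ℂ) * (x : ℂ))) * h k) (k : ℝ) :
    fourierT (fun x : ℝ => ((1 / Real.sqrt (2 * Real.pi) : ℝ) : ℂ) *
      ∫ k : ℝ, Complex.exp (-(Complex.I * (k : ℂ) * (x : ℂ))) * h k) k = h k := by
  have hrefl : (fun x : ℝ => ((1 / Real.sqrt (2 * Real.pi) : ℝ) : ℂ) *
      ∫ k : ℝ, Complex.exp (-(Complex.I * (k : ℂ) * (x : ℂ))) * h k) =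
      fun x => fourierT h (-x) := by
    funext x
    rw [fourierT]
    congr 2
    funext k
    congr 2
    push_cast
    ring
  rw [hrefl] at hv ⊢
  have hF : Integrable (fourierT h) := by simpa using hv.comp_neg
  rw [eq_integral_fourierT hc hh hF k, fourierT, ← integral_neg_eq_self]
  congr 2
  funext x
  rw [neg_neg]
  congr 2
  push_cast
  ring

section Strip

variable {G : ℝ → ℝ → ℂ} {t : ℝ}

theorem integrable_prod_of_strip (hG : IntegrableOn (Function.uncurry G) (univ ×ˢ Ioc 0 t)) :
    Integrable (Function.uncurry G) (volume.prod (volume.restrict (Ioc 0 t))) := by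
  rw [IntegrableOn, Measure.volume_eq_prod, ← Measure.prod_restrict, Measure.restrict_univ] at hG
  exact hG

theorem integrableOn_fourierT_strip
    (hG : IntegrableOn (Function.uncurry G) (univ ×ˢ Ioc 0 t)) (k : ℝ) :
    IntegrableOn (fun s => fourierT (fun x => G x s) k) (Ioc 0 t) := by
  have h := integrable_prod_of_strip hG
  have h1 : Integrable (fun p : ℝ × ℝ => Complex.exp (Complex.I * (k : ℂ) * (p.1 : ℂ)) * G p.1 p.2)
      (volume.prod (volume.restrict (Ioc 0 t))) := by
    refine h.bdd_mul (c := 1) (Continuous.aestronglyMeasurable (by fun_prop))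
      (ae_of_all _ fun p => (norm_exp_I_mul k p.1).le)
  exact (h1.integral_prod_right).const_mul _

/-- The Fourier transform in space commutes with a time integral against a bounded kernel. -/
theorem fourierT_integral_kernel
    (hG : IntegrableOn (Function.uncurry G) (univ ×ˢ Ioc 0 t)) {e : ℝ → ℝ} (he : Continuous e)
    (k : ℝ) :
    Integrable (fun x => ∫ s in Ioc 0 t, (e (t - s) : ℂ) * G x s) ∧
    fourierT (fun x => ∫ s in Ioc 0 t, (e (t - s) : ℂ) * G x s) k =
      ∫ s in Ioc 0 t, (e (t - s) : ℂ) * fourierT (fun x => G x s) k := by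
  have h := integrable_prod_of_strip hG
  obtain ⟨C, hC⟩ := (isCompact_Icc (a := (0 : ℝ)) (b := t)).exists_bound_of_continuousOn
    (f := e) he.continuousOn
  have hae : ∀ᵐ p : ℝ × ℝ ∂(volume.prod (volume.restrict (Ioc 0 t))), p.2 ∈ Ioc 0 t := by
    have : (volume.prod (volume.restrict (Ioc 0 t)) : Measure (ℝ × ℝ)) =
        volume.restrict (univ ×ˢ Ioc 0 t) := by
      rw [Measure.volume_eq_prod, ← Measure.prod_restrict, Measure.restrict_univ]
    rw [this, ae_restrict_iff' (MeasurableSet.univ.prod measurableSet_Ioc)]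
    exact ae_of_all _ fun p hp => hp.2
  have h2 : Integrable (fun p : ℝ × ℝ => (e (t - p.2) : ℂ) * G p.1 p.2)
      (volume.prod (volume.restrict (Ioc 0 t))) := by
    refine h.bdd_mul (c := C) (Continuous.aestronglyMeasurable (by fun_prop)) ?_
    filter_upwards [hae] with p hp
    rw [Complex.norm_real]
    exact hC _ ⟨by linarith [hp.2], by linarith [hp.1]⟩
  have h3 : Integrable (fun p : ℝ × ℝ => Complex.exp (Complex.I * (k : ℂ) * (p.1 : ℂ)) *
      ((e (t - p.2) : ℂ) * G p.1 p.2)) (volume.prod (volume.restrict (Ioc 0 t))) :=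
    h2.bdd_mul (c := 1) (Continuous.aestronglyMeasurable (by fun_prop))
      (ae_of_all _ fun p => (norm_exp_I_mul k p.1).le)
  refine ⟨h2.integral_prod_left, ?_⟩
  unfold fourierT
  simp_rw [← integral_const_mul (Complex.exp _)]
  rw [integral_integral_swap h3, ← integral_const_mul]
  congr 1
  funext s
  rw [mul_left_comm]
  congr 1
  rw [← integral_const_mul]
  congr 1
  funext x
  ring

end Strip

/-! ### Causal convolution with the kernels `e_b` -/

/-- Associativity of causal convolution: if `c` is the convolution of `a` and `b` on `(0, t]`, then
applying `b` and then `a` to an integrable function is the same as applying `c`. -/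
theorem integral_kernel_comp {a b c : ℝ → ℝ} {t C : ℝ} (ht : 0 < t) (ha : Measurable a)
    (hb : Measurable b) {h : ℝ → ℂ} (hh : IntegrableOn h (Ioc 0 t))
    (hint : ∀ r, 0 < r → r ≤ t → IntegrableOn (fun s => b (r - s) * a s) (Ioc 0 r))
    (hC : ∀ r, 0 < r → r ≤ t → ∫ s in Ioc 0 r, ‖b (r - s) * a s‖ ≤ C)
    (hc : ∀ r, 0 < r → r ≤ t → ∫ s in Ioc 0 r, b (r - s) * a s = c r) :
    IntegrableOn (fun s => (a (t - s) : ℂ) * ∫ u in Ioc 0 s, (b (s - u) : ℂ) * h u) (Ioc 0 t) ∧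
    ∫ s in Ioc 0 t, (a (t - s) : ℂ) * ∫ u in Ioc 0 s, (b (s - u) : ℂ) * h u =
      ∫ u in Ioc 0 t, (c (t - u) : ℂ) * h u := by
  have hC0 : 0 ≤ C := (integral_nonneg fun s => norm_nonneg _).trans (hC t ht le_rfl)
  -- with the kernels extended by `0` to the left, all integrals can be taken over the whole line
  set A := indicator (Ioi 0) a with hA
  set B := indicator (Ioi 0) b with hB
  set H := indicator (Ioo 0 t) h with hH
  have hAm : Measurable A := ha.indicator measurableSet_Ioi
  have hBm : Measurable B := hb.indicator measurableSet_Ioi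
  have hHi : Integrable H := by
    rw [hH, integrable_indicator_iff measurableSet_Ioo]
    exact hh.mono_set Ioo_subset_Ioc_self
  have hAB : ∀ u s, A (t - (t - s)) * B (t - s - u) =
      indicator (Ioo 0 (t - u)) (fun s => b (t - u - s) * a s) s := fun u s => by
    simp only [hA, hB, sub_sub_cancel, indicator_apply, mem_Ioi, mem_Ioo]
    by_cases h1 : 0 < s <;> by_cases h2 : s < t - u
    · have h3 : 0 < t - s - u := by linarith
      simp only [h1, h2, h3, and_self, if_true]
      rw [mul_comm, show t - s - u = t - u - s by ring]
    · have h3 : ¬ 0 < t - s - u := by linarith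
      simp [h2, h3]
    · simp [h1]
    · simp [h1]
  have hABint : ∀ u, 0 < u → u < t → Integrable fun s => A (t - s) * B (s - u) := fun u h0 h1 => by
    have : Integrable fun s => A (t - (t - s)) * B (t - s - u) := by
      rw [show (fun s => A (t - (t - s)) * B (t - s - u)) = _ from funext (hAB u),
        integrable_indicator_iff measurableSet_Ioo]
      exact (hint (t - u) (by linarith) (by linarith)).mono_set Ioo_subset_Ioc_self
    simpa using this.comp_sub_left t
  have hABC : ∀ u, 0 < u → u < t → ∫ s, ‖A (t - s) * B (s - u)‖ ≤ C := fun u h0 h1 => by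
    rw [← integral_sub_left_eq_self _ volume t]
    simp_rw [hAB u, norm_indicator_eq_indicator_norm]
    rw [integral_indicator measurableSet_Ioo, ← integral_Ioc_eq_integral_Ioo]
    exact hC (t - u) (by linarith) (by linarith)
  have hABc : ∀ u, 0 < u → u < t → ∫ s, A (t - s) * B (s - u) = c (t - u) := fun u h0 h1 => by
    rw [← integral_sub_left_eq_self _ volume t]
    simp_rw [hAB u]
    rw [integral_indicator measurableSet_Ioo, ← integral_Ioc_eq_integral_Ioo]
    exact hc (t - u) (by linarith) (by linarith)
  have hout : ∀ u, ¬ (0 < u ∧ u < t) → H u = 0 := fun u hu =>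
    indicator_of_notMem (s := Ioo 0 t) hu _
  have hmeas : AEStronglyMeasurable
      (fun p : ℝ × ℝ => ((A (t - p.1) * B (p.1 - p.2) : ℝ) : ℂ) * H p.2)
      (volume.prod volume) := by
    refine AEStronglyMeasurable.mul (Measurable.aestronglyMeasurable (by fun_prop))
      hHi.1.comp_snd
  have hprod : Integrable (fun p : ℝ × ℝ => ((A (t - p.1) * B (p.1 - p.2) : ℝ) : ℂ) * H p.2)
      (volume.prod volume) := by
    rw [integrable_prod_iff' hmeas]
    constructor
    · refine ae_of_all _ fun u => ?_
      by_cases hu : 0 < u ∧ u < t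
      · exact ((hABint u hu.1 hu.2).ofReal).mul_const (H u)
      · simp [hout u hu]
    · refine (hHi.norm.const_mul C).mono' hmeas.norm.prod_swap.integral_prod_right'
        (ae_of_all _ fun u => ?_)
      rw [Real.norm_eq_abs, abs_of_nonneg (integral_nonneg fun s => norm_nonneg _)]
      by_cases hu : 0 < u ∧ u < t
      · simp_rw [norm_mul _ (H _), Complex.norm_real]
        rw [integral_mul_const]
        exact mul_le_mul_of_nonneg_right (hABC u hu.1 hu.2) (norm_nonneg _)
      · simp [hout u hu]
  have hswap := integral_integral_swap
    (f := fun s u => ((A (t - s) * B (s - u) : ℝ) : ℂ) * H u) hprod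
  have hL : ∀ s, ∫ u, ((A (t - s) * B (s - u) : ℝ) : ℂ) * H u =
      indicator (Ioo 0 t) (fun s => (a (t - s) : ℂ) * ∫ u in Ioc 0 s, (b (s - u) : ℂ) * h u) s :=
    fun s => by
      by_cases hs : 0 < s ∧ s < t
      · rw [indicator_of_mem (by exact hs), integral_Ioc_eq_integral_Ioo,
          ← integral_indicator measurableSet_Ioo, ← integral_const_mul]
        congr 1
        funext u
        simp only [hA, hB, hH, indicator_apply, mem_Ioi, mem_Ioo, sub_pos, hs.2, if_true]
        by_cases h1 : 0 < u <;> by_cases h2 : u < s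
        · simp [h1, h2, h2.trans hs.2, mul_assoc]
        · simp [h2]
        · simp [h1]
        · simp [h1]
      · rw [indicator_of_notMem (by exact hs)]
        refine integral_eq_zero_of_ae (ae_of_all _ fun u => ?_)
        simp only [hA, hB, hH, indicator_apply, mem_Ioi, mem_Ioo, sub_pos, Pi.zero_apply]
        by_cases h1 : 0 < u
        · by_cases h2 : s < t
          · have : ¬ u < s := fun h3 => hs ⟨h1.trans h3, h2⟩
            simp [this]
          · simp [h2]
        · simp [h1]
  have hR : ∀ u, ∫ s, ((A (t - s) * B (s - u) : ℝ) : ℂ) * H u =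
      indicator (Ioo 0 t) (fun u => (c (t - u) : ℂ) * h u) u := fun u => by
    rw [integral_mul_const]
    by_cases hu : 0 < u ∧ u < t
    · rw [indicator_of_mem (by exact hu), integral_complex_ofReal, hABc u hu.1 hu.2, hH,
        indicator_of_mem (by exact hu)]
    · rw [hout u hu, indicator_of_notMem (by exact hu), mul_zero]
  have hLint := hprod.integral_prod_left
  simp only [hL] at hLint
  rw [integrable_indicator_iff measurableSet_Ioo, ← integrableOn_Ioc_iff_integrableOn_Ioo] at hLint
  refine ⟨hLint, ?_⟩
  simp_rw [hL, hR] at hswap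
  rw [integral_indicator measurableSet_Ioo, integral_indicator measurableSet_Ioo,
    ← integral_Ioc_eq_integral_Ioo, ← integral_Ioc_eq_integral_Ioo] at hswap
  exact hswap

/-- Convolution with `e_c` after a Riemann-Liouville integral of order `b` is convolution with
`e_{b+c}`. -/
theorem mlKernel_comp_rl {a b c σ t : ℝ} (ha : 1 ≤ a) (hb : 0 < b) (hc : 0 < c) (hbc : 1 ≤ b + c)
    (ht : 0 < t) {h : ℝ → ℂ} (hh : IntegrableOn h (Ioc 0 t)) :
    IntegrableOn (fun s => (mlKernel a c σ (t - s) : ℂ) *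
      ∫ u in Ioc 0 s, (((s - u) ^ (b - 1) / Real.Gamma b : ℝ) : ℂ) * h u) (Ioc 0 t) ∧
    ∫ s in Ioc 0 t, (mlKernel a c σ (t - s) : ℂ) *
      ∫ u in Ioc 0 s, (((s - u) ^ (b - 1) / Real.Gamma b : ℝ) : ℂ) * h u =
      ∫ u in Ioc 0 t, (mlKernel a (b + c) σ (t - u) : ℂ) * h u := by
  obtain ⟨C, hC⟩ := (isCompact_Icc (a := (0 : ℝ)) (b := t)).exists_bound_of_continuousOn
    (continuous_mlKernel ha hbc (-|σ|)).continuousOn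
  refine integral_kernel_comp (a := mlKernel a c σ) (b := fun s => s ^ (b - 1) / Real.Gamma b)
    (c := mlKernel a (b + c) σ) (C := C) ht (measurable_mlKernel ha hc.le σ) (by fun_prop) hh
    (fun r hr _ => integrableOn_rl_mlKernel ha hb hc σ hr) (fun r hr hrt => ?_)
    (fun r hr _ => integral_rl_mlKernel ha hb hc σ hr)
  refine le_trans ?_ ((le_abs_self _).trans (hC r ⟨hr.le, hrt⟩))
  rw [← integral_rl_mlKernel ha hb hc (-|σ|) hr]
  refine setIntegral_mono_on (integrableOn_rl_mlKernel ha hb hc σ hr).norm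
    (integrableOn_rl_mlKernel ha hb hc (-|σ|) hr) measurableSet_Ioc fun s hs => ?_
  have h3 : 0 ≤ r - s := sub_nonneg.2 hs.2
  have hG := Real.Gamma_pos_of_pos hb
  rw [norm_mul, Real.norm_eq_abs, Real.norm_eq_abs, abs_of_nonneg (by positivity)]
  exact mul_le_mul_of_nonneg_left (abs_mlKernel_le ha hc σ hs.1) (by positivity)

/-- The primitive of `e_c * h` is `e_{c+1} * h`. -/
theorem integral_mlKernel_conv {a c σ t : ℝ} (ha : 1 ≤ a) (hc : 1 ≤ c) (ht : 0 < t) {h : ℝ → ℂ}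
    (hh : IntegrableOn h (Ioc 0 t)) :
    ∫ s in Ioc 0 t, ∫ u in Ioc 0 s, (mlKernel a c σ (s - u) : ℂ) * h u =
      ∫ u in Ioc 0 t, (mlKernel a (c + 1) σ (t - u) : ℂ) * h u := by
  have hcont := continuous_mlKernel ha hc σ
  obtain ⟨C, hC⟩ := (isCompact_Icc (a := (0 : ℝ)) (b := t)).exists_bound_of_continuousOn
    hcont.continuousOn
  have hC0 : 0 ≤ C := (norm_nonneg _).trans (hC 0 ⟨le_rfl, ht.le⟩)
  have := integral_kernel_comp (a := fun _ => 1) (b := mlKernel a c σ)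
    (c := mlKernel a (c + 1) σ) (C := C * t) ht measurable_const hcont.measurable hh
    (fun r hr _ => ((hcont.comp (continuous_const.sub continuous_id)).mul
      continuous_const).integrableOn_Ioc) (fun r hr hrt => ?_) (fun r hr _ => ?_)
  · simpa using this.2
  · refine (setIntegral_mono_on (g := fun _ => C) ((hcont.comp
      (continuous_const.sub continuous_id)).mul continuous_const).norm.integrableOn_Ioc
      (integrable_const C) measurableSet_Ioc fun s hs => ?_).trans ?_
    · simp only [Pi.mul_apply, Function.comp_apply, Pi.sub_apply, id, mul_one]
      exact hC _ ⟨by linarith [hs.2], by linarith [hs.1]⟩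
    · simp [hr.le, mul_comm C]
      gcongr
  · have h1 := integral_rl_mlKernel ha one_pos (by linarith : 0 < c) σ hr
    simp only [sub_self, Real.rpow_zero, Real.Gamma_one, div_one, one_mul] at h1
    rw [add_comm c 1, ← h1, ← intervalIntegral.integral_of_le hr.le,
      ← intervalIntegral.integral_of_le hr.le]
    simp_rw [mul_one]
    rw [intervalIntegral.integral_comp_sub_left (mlKernel a c σ) r]
    simp

/-! ### The equation at a fixed point of space, integrated in time -/

theorem integrableOn_comp_sub_left {E : Type*} [NormedAddCommGroup E] {f : ℝ → E} {t : ℝ}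
    (ht : 0 ≤ t) (h : IntegrableOn f (Ioc 0 t)) : IntegrableOn (fun s => f (t - s)) (Ioc 0 t) := by
  rw [← intervalIntegrable_iff_integrableOn_Ioc_of_le ht] at h ⊢
  simpa using (h.comp_sub_left t).symm

theorem setIntegral_comp_sub_left {E : Type*} [NormedAddCommGroup E] [NormedSpace ℝ E] {f : ℝ → E}
    {t : ℝ} (ht : 0 ≤ t) : ∫ s in Ioc 0 t, f (t - s) = ∫ s in Ioc 0 t, f s := by
  rw [← intervalIntegral.integral_of_le ht, ← intervalIntegral.integral_of_le ht,
    intervalIntegral.integral_comp_sub_left f t]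
  simp

/-- Taylor's formula with integral remainder, from the values `g`, `f` of a function and its
derivative at `0+`. -/
theorem taylor_of_tendsto {F₀ F₁ w : ℝ → ℂ} {f g : ℂ} {s : ℝ} (hs : 0 < s)
    (h0 : ∀ r, 0 < r → HasDerivAt F₀ (F₁ r) r) (h1 : ∀ r, 0 < r → HasDerivAt F₁ (w r) r)
    (hg : Tendsto F₀ (𝓝[>] 0) (𝓝 g)) (hf : Tendsto F₁ (𝓝[>] 0) (𝓝 f))
    (hw : IntegrableOn w (Ioc 0 s)) :
    F₀ s = g + s * f +
      ∫ u in Ioc 0 s, (((s - u) ^ ((2 : ℝ) - 1) / Real.Gamma 2 : ℝ) : ℂ) * w u := by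
  -- the derivative of `F₀ r + (s - r) F₁ r` is the integrand of the remainder
  have hP : ∀ r, 0 < r → HasDerivAt (fun r : ℝ => F₀ r + ((s - r : ℝ) : ℂ) * F₁ r)
      (((s - r : ℝ) : ℂ) * w r) r := fun r hr => by
    have hd : HasDerivAt (fun r : ℝ => ((s - r : ℝ) : ℂ)) (((-1 : ℝ)) : ℂ) r :=
      ((hasDerivAt_id r).const_sub s).ofReal_comp
    refine ((h0 r hr).add (hd.mul (h1 r hr))).congr_deriv ?_
    push_cast
    ring
  have hint : IntegrableOn (fun r : ℝ => ((s - r : ℝ) : ℂ) * w r) (Ioc 0 s) := by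
    refine hw.bdd_mul (c := s) (Continuous.aestronglyMeasurable (by fun_prop)) ?_
    refine (ae_restrict_iff' measurableSet_Ioc).2 (ae_of_all _ fun r hr => ?_)
    rw [Complex.norm_real, Real.norm_eq_abs, abs_of_nonneg (by linarith [hr.2])]
    linarith [hr.1]
  have hc : Tendsto (fun r : ℝ => ((s - r : ℝ) : ℂ)) (𝓝[>] 0) (𝓝 (s : ℂ)) := by
    have : Continuous fun r : ℝ => ((s - r : ℝ) : ℂ) := by fun_prop
    have := this.tendsto 0
    rw [sub_zero] at this
    exact this.mono_left nhdsWithin_le_nhds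
  have hend : Tendsto (fun r : ℝ => F₀ r + ((s - r : ℝ) : ℂ) * F₁ r) (𝓝[<] s) (𝓝 (F₀ s)) := by
    have := (hP s hs).continuousAt.tendsto
    simp only [sub_self, Complex.ofReal_zero, zero_mul, add_zero] at this
    exact this.mono_left nhdsWithin_le_nhds
  have key := intervalIntegral.integral_eq_sub_of_hasDerivAt_of_tendsto hs
    (fun r hr => hP r hr.1) ((intervalIntegrable_iff_integrableOn_Ioc_of_le hs.le).2 hint)
    (hg.add (hc.mul hf)) hend
  rw [intervalIntegral.integral_of_le hs.le] at key
  have hG : Real.Gamma 2 = 1 := Real.Gamma_two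
  have he : (2 : ℝ) - 1 = 1 := by norm_num
  simp only [hG, he, Real.rpow_one, div_one]
  rw [key]
  ring

/-- Taylor's formula `F₀ = g + s f + I² w` convolved with `e_{α-1}`. -/
theorem integral_mlKernel_taylor {α σ t : ℝ} (hα : 1 < α) (ht : 0 < t) {F₀ F₁ w : ℝ → ℂ} {f g : ℂ}
    (h0 : ∀ r, 0 < r → HasDerivAt F₀ (F₁ r) r) (h1 : ∀ r, 0 < r → HasDerivAt F₁ (w r) r)
    (hg : Tendsto F₀ (𝓝[>] 0) (𝓝 g)) (hf : Tendsto F₁ (𝓝[>] 0) (𝓝 f))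
    (hw : IntegrableOn w (Ioc 0 t)) :
    ∫ s in Ioc 0 t, (mlKernel α (α - 1) σ (t - s) : ℂ) * F₀ s =
      g * mlKernel α α σ t + f * mlKernel α (α + 1) σ t +
        ∫ u in Ioc 0 t, (mlKernel α (α + 1) σ (t - u) : ℂ) * w u := by
  have hα1 : 0 < α - 1 := by linarith
  obtain ⟨i3, e3⟩ := mlKernel_comp_rl (σ := σ) hα.le two_pos hα1 (by linarith) ht hw
  have i1 := integrableOn_comp_sub_left ht.le (integrableOn_rl_mlKernel hα.le one_pos hα1 σ ht)
  have e1 := setIntegral_comp_sub_left (f := fun s => (t - s) ^ ((1 : ℝ) - 1) / Real.Gamma 1 *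
    mlKernel α (α - 1) σ s) ht.le
  have i2 := integrableOn_comp_sub_left ht.le (integrableOn_rl_mlKernel hα.le two_pos hα1 σ ht)
  have e2 := setIntegral_comp_sub_left (f := fun s => (t - s) ^ ((2 : ℝ) - 1) / Real.Gamma 2 *
    mlKernel α (α - 1) σ s) ht.le
  rw [integral_rl_mlKernel hα.le one_pos hα1 σ ht] at e1
  rw [integral_rl_mlKernel hα.le two_pos hα1 σ ht] at e2
  have hG : Real.Gamma 2 = 1 := Real.Gamma_two
  have he : (2 : ℝ) - 1 = 1 := by norm_num
  rw [show (1 : ℝ) + (α - 1) = α by ring] at e1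
  rw [show (2 : ℝ) + (α - 1) = α + 1 by ring] at e2 e3
  simp only [sub_sub_cancel, hG, he, Real.rpow_one, div_one, sub_self, Real.rpow_zero,
    Real.Gamma_one, one_mul] at i1 e1 i2 e2
  have i1' : IntegrableOn (fun s => (mlKernel α (α - 1) σ (t - s) : ℂ)) (Ioc 0 t) := i1.ofReal
  have i2' : IntegrableOn (fun s => ((s * mlKernel α (α - 1) σ (t - s) : ℝ) : ℂ)) (Ioc 0 t) :=
    i2.ofReal
  have e1' : ∫ s in Ioc 0 t, (mlKernel α (α - 1) σ (t - s) : ℂ) = mlKernel α α σ t := by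
    rw [integral_complex_ofReal, e1]
  have e2' : ∫ s in Ioc 0 t, ((s * mlKernel α (α - 1) σ (t - s) : ℝ) : ℂ) =
      mlKernel α (α + 1) σ t := by rw [integral_complex_ofReal, e2]
  have i12 : IntegrableOn (fun s => g * (mlKernel α (α - 1) σ (t - s) : ℂ) +
      f * ((s * mlKernel α (α - 1) σ (t - s) : ℝ) : ℂ)) (Ioc 0 t) :=
    (i1'.const_mul g).add (i2'.const_mul f)
  rw [← e1', ← e2', ← e3, ← integral_const_mul, ← integral_const_mul,
    ← integral_add (i1'.const_mul g) (i2'.const_mul f), ← integral_add i12 i3]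
  refine setIntegral_congr_fun measurableSet_Ioc fun s hs => ?_
  rw [taylor_of_tendsto hs.1 h0 h1 hg hf (hw.mono_set (Ioc_subset_Ioc_right hs.2))]
  push_cast
  ring

theorem rlIntegral_eq {ν : ℝ} (hν : 0 < ν) (h : ℝ → ℂ) {s : ℝ} (hs : 0 ≤ s) :
    rlIntegral ν h s = ∫ u in Ioc 0 s, (((s - u) ^ (ν - 1) / Real.Gamma ν : ℝ) : ℂ) * h u := by
  rw [rlIntegral, if_neg hν.ne', intervalIntegral.integral_of_le hs, ← integral_const_mul]
  congr 1
  funext u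
  push_cast
  ring

/-- The fractional differential equation in time, integrated: a function whose derivative of order
`α` is `w` and whose initial values are `f`, `g` satisfies
`e_1 * h = g e_α + f e_{α+1} + e_{α+1} * w`, for every `σ`. For `α < 2` this is Taylor's formula for
the integral of order `2 - α` of `h`, convolved with `e_{α-1}`; for `α = 2` it is Taylor's formula
for `h` itself. -/
theorem integral_mlKernel_one_mul {α σ t : ℝ} (hα : 1 < α ∧ α ≤ 2) (ht : 0 < t) {h : ℝ → ℂ}
    {f g : ℂ} (hc : ContinuousOn h (Ioi 0)) (hi : ∀ T, IntegrableOn h (Ioc 0 T))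
    (hd : RLDifferentiable α h) (hf : Tendsto (rlDeriv (α - 1) h) (𝓝[>] 0) (𝓝 f))
    (hg : Tendsto (rlDeriv (α - 2) h) (𝓝[>] 0) (𝓝 g))
    (hw : IntegrableOn (rlDeriv α h) (Ioc 0 t)) :
    ∫ s in Ioc 0 t, (mlKernel α 1 σ (t - s) : ℂ) * h s =
      g * mlKernel α α σ t + f * mlKernel α (α + 1) σ t +
        ∫ u in Ioc 0 t, (mlKernel α (α + 1) σ (t - u) : ℂ) * rlDeriv α h u := by
  have hα0 : 0 < α := by linarith [hα.1]
  have hα1 : 0 < α - 1 := by linarith [hα.1]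
  rcases hα.2.lt_or_eq with h2 | rfl
  · have ho : rlOrder α = 2 := by
      rw [rlOrder, show ⌊α⌋₊ = 1 from
        (Nat.floor_eq_iff hα0.le).2 ⟨by simpa using hα.1.le, by norm_num; exact h2⟩]
    have ho' : rlOrder (α - 1) = 1 := by
      rw [rlOrder, show ⌊α - 1⌋₊ = 0 from
        (Nat.floor_eq_iff hα1.le).2 ⟨by simpa using hα.1.le, by norm_num; linarith⟩]
    set F := rlIntegral (2 - α) h with hF
    have hwF : rlDeriv α h = iteratedDeriv 2 F := by
      funext s
      rw [rlDeriv, if_pos hα0, ho]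
      norm_num
      rfl
    have hfF : rlDeriv (α - 1) h = iteratedDeriv 1 F := by
      funext s
      rw [rlDeriv, if_pos hα1, ho', Nat.cast_one, show 1 - (α - 1) = 2 - α by ring]
    have hgF : rlDeriv (α - 2) h = F := by
      funext s
      rw [rlDeriv, if_neg (by linarith), show -(α - 2) = 2 - α by ring]
    have hdF : ∀ r, 0 < r → ∀ i < 2, DifferentiableAt ℝ (iteratedDeriv i F) r :=
        fun r hr i hi' => by
      have := hd r hr i (by rwa [ho])
      rw [ho] at this
      exact_mod_cast this
    rw [hwF] at hw ⊢
    rw [hfF] at hf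
    rw [hgF] at hg
    rw [← integral_mlKernel_taylor hα.1 ht (F₁ := iteratedDeriv 1 F) (fun r hr => ?_)
      (fun r hr => ?_) hg hf hw]
    · have hcomp := (mlKernel_comp_rl (σ := σ) hα.1.le (by linarith : 0 < 2 - α) hα1
        (by linarith) ht (hi t)).2
      rw [show 2 - α + (α - 1) = 1 by ring] at hcomp
      rw [← hcomp]
      refine setIntegral_congr_fun measurableSet_Ioc fun s hs => ?_
      rw [hF, rlIntegral_eq (by linarith : 0 < 2 - α) h hs.1.le]
    · rw [iteratedDeriv_one]
      have := (hdF r hr 0 two_pos).hasDerivAt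
      rwa [iteratedDeriv_zero] at this
    · rw [show iteratedDeriv 2 F = deriv (iteratedDeriv 1 F) from iteratedDeriv_succ]
      exact (hdF r hr 1 one_lt_two).hasDerivAt
  -- `rlOrder 2 = 3`, so `rlDeriv 2` is the third derivative of the primitive `F`
  · have ho : rlOrder (2 : ℝ) = 3 := by
      rw [rlOrder, show ⌊(2 : ℝ)⌋₊ = 2 from Nat.floor_ofNat 2]
    have ho' : rlOrder ((2 : ℝ) - 1) = 2 := by
      rw [rlOrder, show ⌊(2 : ℝ) - 1⌋₊ = 1 from
        (Nat.floor_eq_iff (by norm_num)).2 ⟨by norm_num, by norm_num⟩]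
    set F := rlIntegral 1 h with hF
    have hwF : rlDeriv 2 h = iteratedDeriv 3 F := by
      funext s
      rw [rlDeriv, if_pos two_pos, ho]
      norm_num
      rfl
    have hfF : rlDeriv (2 - 1) h = iteratedDeriv 2 F := by
      funext s
      rw [rlDeriv, if_pos (by norm_num), ho']
      norm_num
      rfl
    have hgF : rlDeriv (2 - 2) h = h := by
      funext s
      rw [rlDeriv, if_neg (by norm_num), sub_self, neg_zero, rlIntegral, if_pos rfl]
    have hdF : ∀ r, 0 < r → ∀ i < 3, DifferentiableAt ℝ (iteratedDeriv i F) r :=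
        fun r hr i hi' => by
      have := hd r hr i (by rwa [ho])
      rw [ho] at this
      norm_num at this
      exact this
    have hFh : ∀ s, 0 < s → iteratedDeriv 1 F s = h s := fun s hs => by
      have h1 : F = fun s => ∫ u in (0 : ℝ)..s, h u := by
        funext s
        simp [hF, rlIntegral]
      rw [iteratedDeriv_one, h1]
      exact (intervalIntegral.integral_hasDerivAt_right
        ((intervalIntegrable_iff_integrableOn_Ioc_of_le hs.le).2 (hi s))
        (hc.stronglyMeasurableAtFilter isOpen_Ioi s hs) (hc.continuousAt (Ioi_mem_nhds hs))).deriv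
    have hg' : Tendsto (iteratedDeriv 1 F) (𝓝[>] 0) (𝓝 g) := by
      rw [hgF] at hg
      refine hg.congr' ?_
      filter_upwards [self_mem_nhdsWithin] with s hs using (hFh s hs).symm
    rw [hwF] at hw ⊢
    rw [hfF] at hf
    rw [← integral_mlKernel_taylor hα.1 ht (fun r hr => ?_) (fun r hr => ?_) hg' hf hw]
    · refine setIntegral_congr_fun measurableSet_Ioc fun s hs => ?_
      rw [hFh s hs.1]
      norm_num
    · rw [show iteratedDeriv 2 F = deriv (iteratedDeriv 1 F) from iteratedDeriv_succ]
      exact (hdF r hr 1 (by norm_num)).hasDerivAt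
    · rw [show iteratedDeriv 3 F = deriv (iteratedDeriv 2 F) from iteratedDeriv_succ]
      exact (hdF r hr 2 (by norm_num)).hasDerivAt

/-! ### The Fourier transform of a solution -/

theorem continuous_symbol {n : ℕ} {μ γ : Fin n → ℝ} (hγ : ∀ j, 0 < γ j) :
    Continuous (symbol μ γ) := by
  unfold symbol
  exact continuous_finsetSum _ fun j _ =>
    continuous_const.mul (continuous_abs.rpow_const fun k => Or.inr (hγ j).le)

theorem symbol_nonneg {n : ℕ} {μ γ : Fin n → ℝ} (hμ : ∀ j, 0 < μ j) (k : ℝ) : 0 ≤ symbol μ γ k :=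
  Finset.sum_nonneg fun j _ => mul_nonneg (hμ j).le (by positivity)

/-- The Fourier transform turns the Riesz derivatives into multiplication by the symbol. Only the
sum of the Riesz derivatives, as the difference of `w` and `φ`, is known to be integrable. -/
theorem fourierT_of_eq_sum_rieszDeriv {n : ℕ} {μ γ : Fin n → ℝ} (hγ : ∀ j, 0 < γ j)
    {u w φ : ℝ → ℂ} (hu : Integrable u) (hR : ∀ j, RieszDomain (γ j) u) (hw : Integrable w)
    (hφ : Integrable φ) (heq : ∀ x, w x = ∑ j, (μ j : ℂ) * rieszDeriv (γ j) u x + φ x) (k : ℝ) :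
    fourierT w k = -(symbol μ γ k : ℂ) * fourierT u k + fourierT φ k := by
  set h : ℝ → ℂ := fun k => -(symbol μ γ k : ℂ) * fourierT u k with hh
  have hterm : ∀ j, Integrable fun k : ℝ => -((|k| ^ γ j : ℝ) : ℂ) * fourierT u k := fun j => by
    simp only [neg_mul]
    exact (hR j).2.neg
  have hsum : ∀ k, h k = ∑ j, (μ j : ℂ) * (-((|k| ^ γ j : ℝ) : ℂ) * fourierT u k) := fun k => by
    simp only [hh, symbol]
    push_cast
    rw [← Finset.sum_neg_distrib, Finset.sum_mul]
    exact Finset.sum_congr rfl fun j _ => by ring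
  have hint : Integrable h := by
    rw [show h = fun k => ∑ j, (μ j : ℂ) * (-((|k| ^ γ j : ℝ) : ℂ) * fourierT u k) from funext hsum]
    exact integrable_finsetSum _ fun j _ => (hterm j).const_mul _
  have hcont : Continuous h := by
    have h1 := continuous_symbol (μ := μ) hγ
    have h2 := continuous_fourierT hu
    fun_prop
  have hv : (fun x => w x - φ x) = fun x : ℝ => ((1 / Real.sqrt (2 * Real.pi) : ℝ) : ℂ) *
      ∫ k : ℝ, Complex.exp (-(Complex.I * (k : ℂ) * (x : ℂ))) * h k := by
    funext x
    rw [heq x, add_sub_cancel_right]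
    simp only [hsum, Finset.mul_sum]
    rw [integral_finsetSum, Finset.mul_sum]
    · refine Finset.sum_congr rfl fun j _ => ?_
      rw [rieszDeriv, mul_left_comm, ← integral_const_mul]
      congr 2
      funext k
      ring
    · intro j _
      refine ((hterm j).const_mul (μ j : ℂ)).bdd_mul (c := 1)
        (Continuous.aestronglyMeasurable (by fun_prop))
        (ae_of_all _ fun k => (norm_exp_neg_I_mul k x).le)
  have hF := fourierT_integral_exp hcont hint (hv ▸ hw.sub hφ) k
  rw [← hv, fourierT_sub hw hφ] at hF
  linear_combination hF

theorem continuousOn_fourierT_time {N : ℝ → ℝ → ℂ}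
    (hi : ∀ t : ℝ, 0 < t → Integrable (fun x => N x t))
    (hc : ∀ t : ℝ, 0 < t → Tendsto (fun s => ∫ x, ‖N x s - N x t‖) (𝓝 t) (𝓝 0)) (k : ℝ) :
    ContinuousOn (fun s => fourierT (fun x => N x s) k) (Ioi 0) := by
  intro t ht
  refine ContinuousAt.continuousWithinAt ?_
  rw [ContinuousAt, tendsto_iff_norm_sub_tendsto_zero]
  have h0 := (hc t ht).const_mul (1 / Real.sqrt (2 * Real.pi))
  rw [mul_zero] at h0
  refine squeeze_zero' (Eventually.of_forall fun s => norm_nonneg _) ?_ h0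
  filter_upwards [Ioi_mem_nhds ht] with s hs
  rw [← fourierT_sub (hi s hs) (hi t ht)]
  exact norm_fourierT_le _ _

theorem integrableOn_kernel_mul {e : ℝ → ℝ} (he : Continuous e) {t : ℝ} {h : ℝ → ℂ}
    (hh : IntegrableOn h (Ioc 0 t)) : IntegrableOn (fun s => (e (t - s) : ℂ) * h s) (Ioc 0 t) := by
  obtain ⟨C, hC⟩ := (isCompact_Icc (a := (0 : ℝ)) (b := t)).exists_bound_of_continuousOn
    (f := e) he.continuousOn
  refine hh.bdd_mul (c := C) (Continuous.aestronglyMeasurable (by fun_prop))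
    ((ae_restrict_iff' measurableSet_Ioc).2 (ae_of_all _ fun s hs => ?_))
  rw [Complex.norm_real]
  exact hC _ ⟨by linarith [hs.2], by linarith [hs.1]⟩

/-- A causal convolution is continuous if the kernel is continuous and vanishes at `0`: its
extension by `0` to the left is then continuous too. -/
theorem continuousOn_kernel_conv {e : ℝ → ℝ} (he : Continuous e) (he0 : e 0 = 0) {T : ℝ} {h : ℝ → ℂ}
    (hh : IntegrableOn h (Ioc 0 T)) :
    ContinuousOn (fun t => ∫ s in Ioc 0 t, (e (t - s) : ℂ) * h s) (Icc 0 T) := by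
  obtain ⟨C, hC⟩ := (isCompact_Icc (a := (0 : ℝ)) (b := T)).exists_bound_of_continuousOn
    (f := e) he.continuousOn
  -- clamping the argument to `[0, T]` gives a bounded kernel that is `0` for `s > t`
  have hcont : Continuous fun t => ∫ s in Ioc 0 T, (e (max 0 (min (t - s) T)) : ℂ) * h s := by
    refine continuous_of_dominated (bound := fun s => C * ‖h s‖) (fun t => ?_) (fun t => ?_)
      (hh.norm.const_mul C) (ae_of_all _ fun s => by fun_prop)
    · exact (Continuous.aestronglyMeasurable (by fun_prop)).mul hh.1
    · refine (ae_restrict_iff' measurableSet_Ioc).2 (ae_of_all _ fun s hs => ?_)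
      rw [norm_mul, Complex.norm_real]
      exact mul_le_mul_of_nonneg_right
        (hC _ ⟨le_max_left _ _, max_le (hs.1.le.trans hs.2) (min_le_right _ _)⟩) (norm_nonneg _)
  refine hcont.continuousOn.congr fun t ht => ?_
  simp only []
  rw [← integral_indicator measurableSet_Ioc, ← integral_indicator measurableSet_Ioc]
  congr 1
  funext s
  simp only [indicator_apply, mem_Ioc]
  by_cases h1 : 0 < s
  · by_cases h2 : s ≤ t
    · rw [if_pos ⟨h1, h2⟩, if_pos ⟨h1, h2.trans ht.2⟩, min_eq_left (by linarith [ht.2]),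
        max_eq_right (by linarith)]
    · rw [if_neg (fun h => h2 h.2), max_eq_left ((min_le_left _ _).trans (by linarith)), he0]
      simp
  · simp [h1]

theorem eq_of_setIntegral_Ioc_eq {U V : ℝ → ℂ} (hU : ContinuousOn U (Ioi 0))
    (hV : ContinuousOn V (Ioi 0)) (hUi : ∀ T, IntegrableOn U (Ioc 0 T))
    (hVi : ∀ T, IntegrableOn V (Ioc 0 T))
    (h : ∀ t, 0 < t → ∫ s in Ioc 0 t, U s = ∫ s in Ioc 0 t, V s) {t : ℝ} (ht : 0 < t) :
    U t = V t := by
  have hd : ∀ W : ℝ → ℂ, ContinuousOn W (Ioi 0) → (∀ T, IntegrableOn W (Ioc 0 T)) →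
      HasDerivAt (fun s => ∫ u in (0 : ℝ)..s, W u) (W t) t := fun W hW hWi =>
    intervalIntegral.integral_hasDerivAt_right
      ((intervalIntegrable_iff_integrableOn_Ioc_of_le ht.le).2 (hWi t))
      (hW.stronglyMeasurableAtFilter isOpen_Ioi t ht) (hW.continuousAt (Ioi_mem_nhds ht))
  refine (hd U hU hUi).unique ((hd V hV hVi).congr_of_eventuallyEq ?_)
  filter_upwards [Ioi_mem_nhds ht] with s hs
  have hs' : (0 : ℝ) ≤ s := le_of_lt hs
  rw [intervalIntegral.integral_of_le hs', intervalIntegral.integral_of_le hs', h s hs]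

theorem integrableOn_mlKernel {a c : ℝ} (ha : 1 ≤ a) (hc : 0 < c) (σ T : ℝ) :
    IntegrableOn (mlKernel a c σ) (Ioc 0 T) := by
  rcases le_or_gt T 0 with hT | hT
  · simp [Ioc_eq_empty (not_lt.2 hT)]
  · simpa using integrableOn_rl_mlKernel ha one_pos hc σ hT

theorem integral_mlKernel {a c : ℝ} (ha : 1 ≤ a) (hc : 0 < c) (σ : ℝ) {t : ℝ} (ht : 0 < t) :
    ∫ s in Ioc 0 t, mlKernel a c σ s = mlKernel a (c + 1) σ t := by
  simpa [add_comm] using integral_rl_mlKernel ha one_pos hc σ ht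

/-- The time integral of the Fourier transform of a solution. The identity for fixed `x` is used
with `σ` equal to the symbol at `k`; then the terms with the unknown combine by
`e_1 + σ e_{α+1} = 1`. -/
theorem integral_fourierT_solution {n : ℕ} {α : ℝ} {μ γ : Fin n → ℝ} (hα : 1 < α ∧ α ≤ 2)
    (hγ : ∀ j, 0 < γ j) {f g : ℝ → ℂ} {φ N : ℝ → ℝ → ℂ} (hf : Integrable f) (hg : Integrable g)
    (hφ : ∀ T : ℝ, IntegrableOn (Function.uncurry φ) (univ ×ˢ Ioc 0 T)) (hN : Admissible α γ N)
    (heq : ∀ x t : ℝ, 0 < t →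
      rlDeriv α (N x) t = ∑ j, (μ j : ℂ) * rieszDeriv (γ j) (fun y => N y t) x + φ x t)
    (hinit₁ : ∀ x : ℝ, Tendsto (rlDeriv (α - 1) (N x)) (𝓝[>] 0) (𝓝 (f x)))
    (hinit₂ : ∀ x : ℝ, Tendsto (rlDeriv (α - 2) (N x)) (𝓝[>] 0) (𝓝 (g x))) (k : ℝ) {t : ℝ}
    (ht : 0 < t) :
    ∫ s in Ioc 0 t, fourierT (fun x => N x s) k =
      fourierT g k * mlKernel α α (symbol μ γ k) t +
      fourierT f k * mlKernel α (α + 1) (symbol μ γ k) t +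
      ∫ s in Ioc 0 t, (mlKernel α (α + 1) (symbol μ γ k) (t - s) : ℂ) *
        fourierT (fun x => φ x s) k := by
  set σ := symbol μ γ k with hσ
  set w : ℝ → ℝ → ℂ := fun x s => rlDeriv α (N x) s with hwdef
  have hw : IntegrableOn (Function.uncurry w) (univ ×ˢ Ioc 0 t) := hN.int_deriv t
  have hc1 : Continuous (mlKernel α 1 σ) := continuous_mlKernel hα.1.le le_rfl σ
  have hc2 : Continuous (mlKernel α (α + 1) σ) := continuous_mlKernel hα.1.le (by linarith) σ
  obtain ⟨-, hLF⟩ := fourierT_integral_kernel (hN.int_strip t) hc1 k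
  obtain ⟨hRi, hRF⟩ := fourierT_integral_kernel hw hc2 k
  have hae : ∀ᵐ x : ℝ, ∫ s in Ioc 0 t, (mlKernel α 1 σ (t - s) : ℂ) * N x s =
      g x * mlKernel α α σ t + f x * mlKernel α (α + 1) σ t +
        ∫ s in Ioc 0 t, (mlKernel α (α + 1) σ (t - s) : ℂ) * w x s := by
    filter_upwards [(integrable_prod_of_strip hw).prod_right_ae] with x hx
    refine integral_mlKernel_one_mul hα ht ?_ (hN.int_time x) (hN.diff_time x) (hinit₁ x)
      (hinit₂ x) hx
    exact hN.cont.comp (f := fun s => (x, s)) (by fun_prop) fun s hs => ⟨mem_univ _, hs⟩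
  have hFT : fourierT (fun x => ∫ s in Ioc 0 t, (mlKernel α 1 σ (t - s) : ℂ) * N x s) k =
      fourierT g k * mlKernel α α σ t + fourierT f k * mlKernel α (α + 1) σ t +
        fourierT (fun x => ∫ s in Ioc 0 t, (mlKernel α (α + 1) σ (t - s) : ℂ) * w x s) k := by
    have hfg : Integrable fun x => g x * (mlKernel α α σ t : ℂ) +
        f x * (mlKernel α (α + 1) σ t : ℂ) := (hg.mul_const _).add (hf.mul_const _)
    rw [← fourierT_mul_const, ← fourierT_mul_const,
      ← fourierT_add (hg.mul_const _) (hf.mul_const _), ← fourierT_add hfg hRi]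
    unfold fourierT
    congr 1
    refine integral_congr_ae ?_
    filter_upwards [hae] with x hx
    rw [hx]
  rw [hLF, hRF] at hFT
  have hu := integrableOn_fourierT_strip (hN.int_strip t) k
  have hφk := integrableOn_fourierT_strip (hφ t) k
  have hwae : ∀ᵐ s ∂(volume.restrict (Ioc 0 t)), fourierT (fun x => w x s) k =
      -(σ : ℂ) * fourierT (fun x => N x s) k + fourierT (fun x => φ x s) k := by
    filter_upwards [(integrable_prod_of_strip hw).prod_left_ae,
      (integrable_prod_of_strip (hφ t)).prod_left_ae, ae_restrict_mem measurableSet_Ioc]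
      with s h1 h2 hs
    exact fourierT_of_eq_sum_rieszDeriv hγ (hN.int_space s hs.1) (hN.riesz s hs.1) h1 h2
      (fun x => heq x s hs.1) k
  have hsplit : ∫ s in Ioc 0 t, (mlKernel α (α + 1) σ (t - s) : ℂ) * fourierT (fun x => w x s) k =
      -(σ : ℂ) * (∫ s in Ioc 0 t, (mlKernel α (α + 1) σ (t - s) : ℂ) *
        fourierT (fun x => N x s) k) +
      ∫ s in Ioc 0 t, (mlKernel α (α + 1) σ (t - s) : ℂ) * fourierT (fun x => φ x s) k := by
    rw [← integral_const_mul, ← integral_add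
      ((integrableOn_kernel_mul hc2 hu).const_mul _) (integrableOn_kernel_mul hc2 hφk)]
    refine integral_congr_ae ?_
    filter_upwards [hwae] with s hs
    rw [hs]
    ring
  have hone : ∫ s in Ioc 0 t, fourierT (fun x => N x s) k =
      (∫ s in Ioc 0 t, (mlKernel α 1 σ (t - s) : ℂ) * fourierT (fun x => N x s) k) +
      (σ : ℂ) * ∫ s in Ioc 0 t, (mlKernel α (α + 1) σ (t - s) : ℂ) *
        fourierT (fun x => N x s) k := by
    rw [← integral_const_mul, ← integral_add (integrableOn_kernel_mul hc1 hu)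
      ((integrableOn_kernel_mul hc2 hu).const_mul _), integral_Ioc_eq_integral_Ioo,
      integral_Ioc_eq_integral_Ioo]
    refine setIntegral_congr_fun measurableSet_Ioo fun s hs => ?_
    have := mlKernel_one_add hα.1.le σ (sub_pos.2 hs.2)
    have h1 : (mlKernel α 1 σ (t - s) : ℂ) + σ * mlKernel α (α + 1) σ (t - s) = 1 := by
      exact_mod_cast this
    linear_combination (-fourierT (fun x => N x s) k) * h1
  rw [hone, hFT, hsplit]
  ring

/-- The Fourier transform of a solution, by differentiating the time integral. -/
theorem fourierT_solution {n : ℕ} {α : ℝ} {μ γ : Fin n → ℝ} (hα : 1 < α ∧ α ≤ 2)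
    (hγ : ∀ j, 0 < γ j) {f g : ℝ → ℂ} {φ N : ℝ → ℝ → ℂ} (hf : Integrable f) (hg : Integrable g)
    (hφ : ∀ T : ℝ, IntegrableOn (Function.uncurry φ) (univ ×ˢ Ioc 0 T)) (hN : Admissible α γ N)
    (heq : ∀ x t : ℝ, 0 < t →
      rlDeriv α (N x) t = ∑ j, (μ j : ℂ) * rieszDeriv (γ j) (fun y => N y t) x + φ x t)
    (hinit₁ : ∀ x : ℝ, Tendsto (rlDeriv (α - 1) (N x)) (𝓝[>] 0) (𝓝 (f x)))
    (hinit₂ : ∀ x : ℝ, Tendsto (rlDeriv (α - 2) (N x)) (𝓝[>] 0) (𝓝 (g x))) (k : ℝ) {t : ℝ}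
    (ht : 0 < t) :
    fourierT (fun x => N x t) k =
      fourierT g k * mlKernel α (α - 1) (symbol μ γ k) t +
      fourierT f k * mlKernel α α (symbol μ γ k) t +
      ∫ s in Ioc 0 t, (mlKernel α α (symbol μ γ k) (t - s) : ℂ) * fourierT (fun x => φ x s) k := by
  set σ := symbol μ γ k with hσ
  have hα1 : 0 < α - 1 := by linarith [hα.1]
  have hc : Continuous (mlKernel α α σ) := continuous_mlKernel hα.1.le hα.1.le σ
  have hc0 : mlKernel α α σ 0 = 0 := by simp [mlKernel, Real.zero_rpow hα1.ne']
  have hφk := fun T => integrableOn_fourierT_strip (hφ T) k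
  have hconv := fun T => continuousOn_kernel_conv hc hc0 (hφk T)
  have hconvi : ∀ T, IntegrableOn (fun t => ∫ s in Ioc 0 t, (mlKernel α α σ (t - s) : ℂ) *
      fourierT (fun x => φ x s) k) (Ioc 0 T) := fun T =>
    ((hconv T).integrableOn_Icc).mono_set Ioc_subset_Icc_self
  have hi1 : ∀ T, IntegrableOn (fun t => fourierT g k * (mlKernel α (α - 1) σ t : ℂ)) (Ioc 0 T) :=
    fun T => (Integrable.ofReal (integrableOn_mlKernel hα.1.le hα1 σ T)).const_mul _
  have hi2 : ∀ T, IntegrableOn (fun t => fourierT f k * (mlKernel α α σ t : ℂ)) (Ioc 0 T) :=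
    fun T => (Integrable.ofReal (integrableOn_mlKernel hα.1.le (by linarith) σ T)).const_mul _
  have hi12 : ∀ T, IntegrableOn (fun t => fourierT g k * (mlKernel α (α - 1) σ t : ℂ) +
      fourierT f k * (mlKernel α α σ t : ℂ)) (Ioc 0 T) := fun T => (hi1 T).add (hi2 T)
  refine eq_of_setIntegral_Ioc_eq (U := fun t => fourierT (fun x => N x t) k)
    (V := fun t => fourierT g k * mlKernel α (α - 1) σ t + fourierT f k * mlKernel α α σ t +
      ∫ s in Ioc 0 t, (mlKernel α α σ (t - s) : ℂ) * fourierT (fun x => φ x s) k)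
    (continuousOn_fourierT_time hN.int_space hN.cont_L1 k) ?_
    (fun T => integrableOn_fourierT_strip (hN.int_strip T) k)
    (fun T => (hi12 T).add (hconvi T)) (fun t ht => ?_) ht
  · intro t ht
    refine ContinuousAt.continuousWithinAt ?_
    have h1 : ContinuousAt (fun t => (mlKernel α (α - 1) σ t : ℂ)) t :=
      Complex.continuous_ofReal.continuousAt.comp (continuousAt_mlKernel hα.1.le hα1.le σ ht)
    have h2 : ContinuousAt (fun t => (mlKernel α α σ t : ℂ)) t :=
      Complex.continuous_ofReal.continuousAt.comp hc.continuousAt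
    exact ((continuousAt_const.mul h1).add (continuousAt_const.mul h2)).add
      ((hconv (t + 1)).continuousAt (Icc_mem_nhds ht (lt_add_one t)))
  · rw [integral_fourierT_solution hα hγ hf hg hφ hN heq hinit₁ hinit₂ k ht,
      integral_add (hi12 t) (hconvi t), integral_add (hi1 t) (hi2 t), integral_const_mul,
      integral_const_mul, integral_complex_ofReal, integral_complex_ofReal,
      integral_mlKernel hα.1.le hα1 σ ht, integral_mlKernel hα.1.le (by linarith) σ ht,
      integral_mlKernel_conv hα.1.le hα.1.le ht (hφk t), sub_add_cancel]

/-! ### The representation formula -/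

theorem integrable_mittagLeffler_mul {a b t : ℝ} (ha : 1 ≤ a) (hb : 0 ≤ b) {σ : ℝ → ℝ}
    (hσ : Continuous σ) (hσ0 : ∀ k, 0 ≤ σ k) (ht : 0 < t)
    (hE : ∃ C, ∀ y : ℝ, 0 ≤ y → |mittagLeffler a b (-y)| ≤ C) {F : ℝ → ℂ} (hF : Integrable F) :
    Integrable fun k : ℝ => (mittagLeffler a b (-σ k * t ^ a) : ℂ) * F k := by
  obtain ⟨C, hC⟩ := hE
  have h1 := continuous_mittagLeffler ha hb
  refine hF.bdd_mul (c := C) (Continuous.aestronglyMeasurable (by fun_prop))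
    (ae_of_all _ fun k => ?_)
  rw [Complex.norm_real, Real.norm_eq_abs, neg_mul]
  exact hC _ (mul_nonneg (hσ0 k) (by positivity))

/-- Reversal of time and exchange of the variables, for a function integrable on a strip. -/
theorem integrable_strip_reverse {Φ : ℝ → ℝ → ℂ} {t : ℝ}
    (h : IntegrableOn (Function.uncurry Φ) (univ ×ˢ Ioc 0 t)) :
    Integrable (fun p : ℝ × ℝ => Φ p.2 (t - p.1)) ((volume.restrict (Ioc 0 t)).prod volume) := by
  have hswap := (integrable_prod_of_strip h).swap
  have hmp : MeasurePreserving (fun s : ℝ => t - s) (volume.restrict (Ioc 0 t))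
      (volume.restrict (Ioc 0 t)) := by
    have := (Measure.measurePreserving_sub_left volume t).restrict_preimage
      (measurableSet_Ioc (a := (0 : ℝ)) (b := t))
    rw [preimage_const_sub_Ioc, sub_zero, sub_self] at this
    rwa [Measure.restrict_congr_set (Ico_ae_eq_Ioc (μ := volume) (a := (0 : ℝ)) (b := t))] at this
  have hmp2 := hmp.prod (MeasurePreserving.id (volume : Measure ℝ))
  exact (hmp2.integrable_comp hswap.1).2 hswap

theorem corollary1 (n : ℕ) (α : ℝ) (μ γ : Fin n → ℝ)
    (hα : 1 < α ∧ α ≤ 2) (hμ : ∀ j, 0 < μ j) (hγ : ∀ j, 0 < γ j ∧ γ j ≤ 2)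
    -- the data: integrable, with integrable Fourier transforms
    (f g : ℝ → ℂ) (φ : ℝ → ℝ → ℂ)
    (hf : Integrable f) (hf' : Integrable (fourierT f))
    (hg : Integrable g) (hg' : Integrable (fourierT g))
    (hφ : ∀ T : ℝ, IntegrableOn (Function.uncurry φ) (univ ×ˢ Ioc 0 T))
    (hφ' : ∀ T : ℝ, IntegrableOn
      (fun p : ℝ × ℝ => fourierT (fun x => φ x p.2) p.1) (univ ×ˢ Ioc 0 T))
    -- a solution of the problem
    (N : ℝ → ℝ → ℂ) (hN : Admissible α γ N)
    (heq : ∀ x t : ℝ, 0 < t →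
      rlDeriv α (N x) t = ∑ j, (μ j : ℂ) * rieszDeriv (γ j) (fun y => N y t) x + φ x t)
    (hinit₁ : ∀ x : ℝ, Tendsto (rlDeriv (α - 1) (N x)) (𝓝[>] 0) (𝓝 (f x)))
    (hinit₂ : ∀ x : ℝ, Tendsto (rlDeriv (α - 2) (N x)) (𝓝[>] 0) (𝓝 (g x)))
    (hdecay : ∀ t : ℝ, 0 < t →
      Tendsto (fun x => N x t) atTop (𝓝 0) ∧ Tendsto (fun x => N x t) atBot (𝓝 0)) :
    ∀ t : ℝ, 0 < t →
      -- the integrals in the formula converge absolutely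
      Integrable (fun k : ℝ =>
        (mittagLeffler α α (-symbol μ γ k * t ^ α) : ℂ) * fourierT f k) ∧
      Integrable (fun k : ℝ =>
        (mittagLeffler α (α - 1) (-symbol μ γ k * t ^ α) : ℂ) * fourierT g k) ∧
      IntegrableOn (fun p : ℝ × ℝ =>
        ((p.1 ^ (α - 1) * mittagLeffler α α (-symbol μ γ p.2 * p.1 ^ α) : ℝ) : ℂ) *
          fourierT (fun y => φ y (t - p.1)) p.2) (Ioc 0 t ×ˢ univ) ∧
      -- and the formula holds
      ∀ x : ℝ, N x t =
        ((t ^ (α - 1) / Real.sqrt (2 * Real.pi) : ℝ) : ℂ) *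
          (∫ k : ℝ, Complex.exp (-(Complex.I * (k : ℂ) * (x : ℂ))) *
            (mittagLeffler α α (-symbol μ γ k * t ^ α) : ℂ) * fourierT f k) +
        ((t ^ (α - 2) / Real.sqrt (2 * Real.pi) : ℝ) : ℂ) *
          (∫ k : ℝ, Complex.exp (-(Complex.I * (k : ℂ) * (x : ℂ))) *
            (mittagLeffler α (α - 1) (-symbol μ γ k * t ^ α) : ℂ) * fourierT g k) +
        ((1 / Real.sqrt (2 * Real.pi) : ℝ) : ℂ) *
          ∫ ξ in (0 : ℝ)..t, ((ξ ^ (α - 1) : ℝ) : ℂ) *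
            ∫ k : ℝ, (mittagLeffler α α (-symbol μ γ k * ξ ^ α) : ℂ) *
              Complex.exp (-(Complex.I * (k : ℂ) * (x : ℂ))) *
              fourierT (fun y => φ y (t - ξ)) k := by
  intro t ht
  have hσc : Continuous (symbol μ γ) := continuous_symbol fun j => (hγ j).1
  have hσ0 := symbol_nonneg (γ := γ) hμ
  have hα1 : 0 < α - 1 := by linarith [hα.1]
  have hI1 := integrable_mittagLeffler_mul hα.1.le (by linarith) hσc hσ0 ht
    (exists_abs_mittagLeffler_self_le hα) hf'
  have hI2 := integrable_mittagLeffler_mul hα.1.le hα1.le hσc hσ0 ht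
    (exists_abs_mittagLeffler_sub_one_le hα) hg'
  have hI3 : Integrable (fun p : ℝ × ℝ =>
      ((p.1 ^ (α - 1) * mittagLeffler α α (-symbol μ γ p.2 * p.1 ^ α) : ℝ) : ℂ) *
        fourierT (fun y => φ y (t - p.1)) p.2) ((volume.restrict (Ioc 0 t)).prod volume) := by
    obtain ⟨C, hC⟩ := exists_abs_mittagLeffler_self_le hα
    have hE := continuous_mittagLeffler hα.1.le (by linarith : 0 ≤ α)
    have hp1 : Continuous fun x : ℝ => x ^ (α - 1) := Real.continuous_rpow_const hα1.le
    have hp2 : Continuous fun x : ℝ => x ^ α := Real.continuous_rpow_const (by linarith)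
    have hcont : Continuous fun p : ℝ × ℝ =>
        ((p.1 ^ (α - 1) * mittagLeffler α α (-symbol μ γ p.2 * p.1 ^ α) : ℝ) : ℂ) := by
      have h1 := hp1.comp (continuous_fst (X := ℝ) (Y := ℝ))
      have h2 := hp2.comp (continuous_fst (X := ℝ) (Y := ℝ))
      have h3 := hσc.comp (continuous_snd (X := ℝ) (Y := ℝ))
      exact Complex.continuous_ofReal.comp (h1.mul (hE.comp (h3.neg.mul h2)))
    refine (integrable_strip_reverse (Φ := fun k s => fourierT (fun y => φ y s) k) (hφ' t)).bdd_mul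
      (c := t ^ (α - 1) * C) hcont.aestronglyMeasurable ?_
    have hae : ∀ᵐ p : ℝ × ℝ ∂((volume.restrict (Ioc 0 t)).prod volume), p.1 ∈ Ioc 0 t :=
      Measure.quasiMeasurePreserving_fst.ae (ae_restrict_mem measurableSet_Ioc)
    filter_upwards [hae] with p hp
    have h0 := hp.1
    rw [Complex.norm_real, norm_mul, Real.norm_eq_abs, Real.norm_eq_abs,
      abs_of_pos (Real.rpow_pos_of_pos hp.1 _), neg_mul]
    exact mul_le_mul (Real.rpow_le_rpow hp.1.le hp.2 hα1.le)
      (hC _ (mul_nonneg (hσ0 _) (by positivity))) (abs_nonneg _) (by positivity)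
  refine ⟨hI1, hI2, ?_, fun x => ?_⟩
  · rw [IntegrableOn, Measure.volume_eq_prod, ← Measure.prod_restrict, Measure.restrict_univ]
    exact hI3
  have hsol : ∀ k, fourierT (fun x => N x t) k =
      ((t ^ (α - 2) : ℝ) : ℂ) * ((mittagLeffler α (α - 1) (-symbol μ γ k * t ^ α) : ℂ) *
        fourierT g k) +
      ((t ^ (α - 1) : ℝ) : ℂ) * ((mittagLeffler α α (-symbol μ γ k * t ^ α) : ℂ) *
        fourierT f k) +
      ∫ ξ in Ioc 0 t, ((ξ ^ (α - 1) * mittagLeffler α α (-symbol μ γ k * ξ ^ α) : ℝ) : ℂ) *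
        fourierT (fun y => φ y (t - ξ)) k := fun k => by
    rw [fourierT_solution hα (fun j => (hγ j).1) hf hg hφ hN heq hinit₁ hinit₂ k ht,
      ← setIntegral_comp_sub_left ht.le]
    simp only [sub_sub_cancel, mlKernel]
    rw [show α - 1 - 1 = α - 2 by ring]
    push_cast
    ring
  have hI3k : Integrable fun k => ∫ ξ in Ioc 0 t,
      ((ξ ^ (α - 1) * mittagLeffler α α (-symbol μ γ k * ξ ^ α) : ℝ) : ℂ) *
        fourierT (fun y => φ y (t - ξ)) k := hI3.integral_prod_right
  have hFint : Integrable (fourierT fun x => N x t) := by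
    rw [show (fourierT fun x => N x t) = _ from funext hsol]
    exact ((hI2.const_mul _).add (hI1.const_mul _)).add hI3k
  have hcontN : Continuous fun x => N x t :=
    hN.cont.comp_continuous (f := fun x => (x, t)) (by fun_prop) fun y => ⟨mem_univ _, ht⟩
  have hexp : ∀ {F : ℝ → ℂ}, Integrable F →
      Integrable fun k : ℝ => Complex.exp (-(Complex.I * (k : ℂ) * (x : ℂ))) * F k := fun hF =>
    hF.bdd_mul (c := 1) (Continuous.aestronglyMeasurable (by fun_prop))
      (ae_of_all _ fun k => (norm_exp_neg_I_mul k x).le)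
  have hswapint : Integrable (fun p : ℝ × ℝ => Complex.exp (-(Complex.I * (p.2 : ℂ) * (x : ℂ))) *
      (((p.1 ^ (α - 1) * mittagLeffler α α (-symbol μ γ p.2 * p.1 ^ α) : ℝ) : ℂ) *
        fourierT (fun y => φ y (t - p.1)) p.2)) ((volume.restrict (Ioc 0 t)).prod volume) :=
    hI3.bdd_mul (c := 1) (Continuous.aestronglyMeasurable (by fun_prop))
      (ae_of_all _ fun p => (norm_exp_neg_I_mul p.2 x).le)
  have h3 : ∫ k : ℝ, Complex.exp (-(Complex.I * (k : ℂ) * (x : ℂ))) *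
      ∫ ξ in Ioc 0 t, ((ξ ^ (α - 1) * mittagLeffler α α (-symbol μ γ k * ξ ^ α) : ℝ) : ℂ) *
        fourierT (fun y => φ y (t - ξ)) k =
      ∫ ξ in (0 : ℝ)..t, ((ξ ^ (α - 1) : ℝ) : ℂ) *
        ∫ k : ℝ, (mittagLeffler α α (-symbol μ γ k * ξ ^ α) : ℂ) *
          Complex.exp (-(Complex.I * (k : ℂ) * (x : ℂ))) *
          fourierT (fun y => φ y (t - ξ)) k := by
    rw [intervalIntegral.integral_of_le ht.le]
    simp_rw [← integral_const_mul]
    rw [← integral_integral_swap hswapint]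
    congr 1
    funext ξ
    congr 1
    funext k
    push_cast
    ring
  rw [eq_integral_fourierT hcontN (hN.int_space t ht) hFint x, ← h3]
  simp_rw [hsol, mul_add]
  have h12 : Integrable fun k : ℝ => Complex.exp (-(Complex.I * (k : ℂ) * (x : ℂ))) *
      (((t ^ (α - 2) : ℝ) : ℂ) * ((mittagLeffler α (α - 1) (-symbol μ γ k * t ^ α) : ℂ) *
        fourierT g k)) + Complex.exp (-(Complex.I * (k : ℂ) * (x : ℂ))) *
      (((t ^ (α - 1) : ℝ) : ℂ) * ((mittagLeffler α α (-symbol μ γ k * t ^ α) : ℂ) *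
        fourierT f k)) := (hexp (hI2.const_mul _)).add (hexp (hI1.const_mul _))
  rw [integral_add h12 (hexp hI3k),
    integral_add (hexp (hI2.const_mul _)) (hexp (hI1.const_mul _))]
  have hpull : ∀ (c : ℂ) (F : ℝ → ℂ),
      ∫ k : ℝ, Complex.exp (-(Complex.I * (k : ℂ) * (x : ℂ))) * (c * F k) =
      c * ∫ k : ℝ, Complex.exp (-(Complex.I * (k : ℂ) * (x : ℂ))) * F k := fun c F => by
    simp_rw [mul_left_comm _ c, integral_const_mul]
  rw [hpull, hpull]
  simp_rw [mul_assoc]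
  push_cast
  ring
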